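/- **Lemma (trajectory PMB update).** *Setting.* Let $k\ge 0$, $n_x\ge 1$, $n_z\ge 0$ and let $T_{(k)}=\biguplus_{(t,\nu)\in I_{(k)}}\{t\}\times\mathbb{R}^{\nu n_x}$, $I_{(k)}=\{(t,\nu):0\le t\le k,\ 1\le\nu\le k-t+1\}$, be the space of trajectories $X=(t,x^{1:\nu})$ up to time step $k$, with $\int\pi(X)\,dX=\sum_{(t,\nu)\in I_{(k)}}\int\pi(t,x^{1:\nu})\,dx^{1:\nu}$ and $\langle a,b\rangle=\int a(X)b(X)\,dX$. For a function $\pi$ on the finite subsets of $T_{(k)}$ let $\int\pi(\mathbf{X})\,\delta\mathbf{X}=\sum_{q\ge 0}\frac1{q!}\int\pi(\{X_1,\dots,X_q\})\,dX_{1:q}$. The Poisson density with intensity $\lambda$ is $\mathbf{X}\mapsto e^{-\int\lambda}\prod_{X\in\mathbf{X}}\lambda(X)$; the Bernoulli density with parameters $r,p$ is $1-r$ at $\emptyset$, $r\,p(X)$ at $\{X\}$ and $0$ elsewhere. All functions below are measurable. *Measurement model.* A target state $x\in\mathbb{R}^{n_x}$ is detected with probability $p^D(x)\in[0,1]$ and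 then generates one measurement in $\mathbb{R}^{n_z}$ with probability density $l(\cdot|x)$; clutter is Poisson with integrable intensity $\lambda^C\ge 0$; all these are independent. For $X=(t,x^{1:\nu})$ put $p^D_k(X)=p^D(x^\nu)$ if $t+\nu-1=k$, $p_k^D(X)=0$ otherwise, and $l(z|X)=l(z|x^\nu)$. The density of the measurement set $\mathbf{z}$ given the set $\mathbf{X}$ of trajectories is therefore $$\ell(\mathbf{z}|\mathbf{X})=\sum_{\mathbf{z}^c\uplus\biguplus_{X\in\mathbf{X}}\mathbf{z}_X=\mathbf{z}}e^{-\int\lambda^C}\prod_{z\in\mathbf{z}^c}\lambda^C(z)\prod_{X\in\mathbf{X}}b_X(\mathbf{z}_X),$$ with $b_X$ the Bernoulli density with parameters $p^D_k(X)$ and $l(\cdot|X)$. *Prior and posterior.* Let the predicted density be the PMB density $$f(\mathbf{X})=\sum_{\mathbf{X}^1\uplus\dots\uplus\mathbf{X}^n\uplus\mathbf{Y}=\mathbf{X}}f^p(\mathbf{Y})\prod_{i=1}^n f^i(\mathbf{X}^i),$$ where $f^p$ is Poisson with integrable intensity $\lambda\ge 0$ and $f^i$ is Bernoulli with $r^i\in[0,1]$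 and probability density $p^i$ on $T_{(k)}$. Let $\mathbf{z}_k=\{z^1,\dots,z^m\}$ be a set of $m$ distinct measurements such that $\langle p^i,l(z^j|\cdot)p^D_k\rangle$ and $\langle\lambda,l(z^j|\cdot)p^D_k\rangle$ are finite for all $i,j$ and $\int\ell(\mathbf{z}_k|\mathbf{X})f(\mathbf{X})\,\delta\mathbf{X}>0$. *Claim.* The set integral $\int\ell(\mathbf{z}_k|\mathbf{X})f(\mathbf{X})\,\delta\mathbf{X}$ converges, and the Bayesian update $$f_{k|k}(\mathbf{X})=\frac{\ell(\mathbf{z}_k|\mathbf{X})f(\mathbf{X})}{\int\ell(\mathbf{z}_k|\mathbf{X}')f(\mathbf{X}')\,\delta\mathbf{X}'}$$ is the PMBM density $$\sum_{\mathbf{Y}\uplus\mathbf{W}=\mathbf{X}}f^p_{k|k}(\mathbf{Y})\sum_{a\in\mathcal{A}_k}w^a\sum_{\mathbf{X}^1\uplus\dots\uplus\mathbf{X}^{n+m}=\mathbf{W}}\ \prod_{i=1}^{n+m}f^{i,a_i}_{k|k}(\mathbf{X}^i),\qquad w^a=\frac{\prod_i w^{i,a_i}}{\sum_{b\in\mathcal{A}_k}\prod_i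 w^{i,b_i}},$$ with the following parameters, where $f^p_{k|k}$ is Poisson with intensity $\lambda_{k|k}(X)=(1-p^D_k(X))\lambda(X)$, and $f^{i,a}_{k|k}$ is Bernoulli with parameters $r^{i,a}$ and $p^{i,a}$. * For $i\le n$ there are $h_i=m+1$ local hypotheses. Misdetection: $\mathcal{M}(i,1)=\emptyset$, $w^{i,1}=1-r^i\langle p^i,p^D_k\rangle$, $r^{i,1}=\dfrac{r^i\langle p^i,1-p^D_k\rangle}{1-r^i\langle p^i,p^D_k\rangle}$, $p^{i,1}(X)=\dfrac{(1-p^D_k(X))p^i(X)}{\langle p^i,1-p^D_k\rangle}$. Detection with $z^j$: $\mathcal{M}(i,1+j)=\{j\}$, $w^{i,1+j}=r^i\langle p^i,l(z^j|\cdot)p^D_k\rangle$, $r^{i,1+j}=1$, $p^{i,1+j}(X)=\dfrac{l(z^j|X)p^D_k(X)p^i(X)}{\langle p^i,l(z^j|\cdot)p^D_k\rangle}$. * For $i=n+j$, $1\le j\le m$, there are $h_i=2$ local hypotheses: $\mathcal{M}(i,1)=\emptyset$, $w^{i,1}=1$, $r^{i,1}=0$ (the density $p^{i,1}$ is irrelevant);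 and $\mathcal{M}(i,2)=\{j\}$, $w^{i,2}=\lambda^C(z^j)+\langle\lambda,l(z^j|\cdot)p^D_k\rangle$, $r^{i,2}=\langle\lambda,l(z^j|\cdot)p^D_k\rangle/w^{i,2}$, $p^{i,2}(X)=\dfrac{l(z^j|X)p^D_k(X)\lambda(X)}{\langle\lambda,l(z^j|\cdot)p^D_k\rangle}$. * $\mathcal{A}_k$ is the set of all $a=(a_1,\dots,a_{n+m})$ with $a_i\in\{1,\dots,h_i\}$, $\bigcup_i\mathcal{M}(i,a_i)=\{1,\dots,m\}$ and $\mathcal{M}(i,a_i)\cap\mathcal{M}(i',a_{i'})=\emptyset$ for all $i\ne i'$. A quotient with zero denominator is read as $0$. These parameters are valid: $\lambda_{k|k}\ge 0$ is integrable, $w^{i,a}\ge 0$, $0\le r^{i,a}\le 1$, $p^{i,a}$ is a probability density whenever $w^{i,a}r^{i,a}\neq 0$, and $\sum_{b\in\mathcal{A}_k}\prod_i w^{i,b_i}>0$. The two densities agree at $\{X_1,\dots,X_q\}$ for all $q\ge 0$ and almost all $(X_1,\dots,X_q)$; they agree at every finite set of trajectories if, for each denominator of a $p^{i,a}$ above that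 is zero, the corresponding numerator vanishes identically (in particular if none of these denominators is zero). The statement covers both the set of all trajectories and the set of alive trajectories: if $\lambda$ and all $p^i$ vanish at each $(t,x^{1:\nu})$ with $t+\nu-1\ne k$, then so do $\lambda_{k|k}$ and all $p^{i,a}$ (with $p^{i,1}=0$ chosen for $i>n$). -/

import Mathlib

open MeasureTheory

namespace TPMB

noncomputable section

/-- The pairs `(t, ν)` of a start time `t ≤ k` and a length `ν ≥ 1` such that the trajectory ends
(at time `t + ν - 1`) no later than `k`. -/
abbrev TrajIndex (k : ℕ) : Type :=
  {q : ℕ × ℕ // q.1 ≤ k ∧ 1 ≤ q.2 ∧ q.1 + q.2 ≤ k + 1}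

/-- The space of single trajectories `(t, x^{1:ν})` up to time step `k` with target states in
`ℝ^nx`: the disjoint union over `(t, ν)` of the spaces of sequences of `ν` states. -/
abbrev Trajectory (k nx : ℕ) : Type :=
  Σ q : TrajIndex k, (Fin q.1.2 → (Fin nx → ℝ))

namespace Trajectory

variable {k nx : ℕ}

/-- The start time `t`. -/
def start (X : Trajectory k nx) : ℕ := X.1.1.1

/-- The length `ν`. -/
def length (X : Trajectory k nx) : ℕ := X.1.1.2

/-- The last state `x^ν`. -/
def last (X : Trajectory k nx) : Fin nx → ℝ :=
  X.2 ⟨X.1.1.2 - 1, Nat.sub_lt X.1.2.2.1 Nat.one_pos⟩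

/-- The trajectory is alive at time step `k`, that is `t + ν - 1 = k`. -/
def IsAlive (X : Trajectory k nx) : Prop := X.start + X.length = k + 1

/-- The reference measure `dX`: Lebesgue measure on each of the (finitely many) spaces of state
sequences, so that `∫ π(X) dX = ∑_{(t,ν)} ∫ π(t, x^{1:ν}) dx^{1:ν}`. -/
instance : MeasureSpace (Trajectory k nx) where
  volume := Measure.sum fun q : TrajIndex k =>
    (volume : Measure (Fin q.1.2 → (Fin nx → ℝ))).map
      (fun x => (⟨q, x⟩ : Trajectory k nx))

end Trajectory

/-! Random finite sets: set integrals and multiobject densities. -/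

section RandomFiniteSets

variable {α : Type*}

/-- A probability density on `α` with respect to the reference measure. -/
def IsDensity [MeasureSpace α] (p : α → ℝ) : Prop :=
  Measurable p ∧ (∀ x, 0 ≤ p x) ∧ ∫ x, p x = 1

/-- The inner product `⟨a, b⟩ = ∫ a(X) b(X) dX`. -/
def inn [MeasureSpace α] (a b : α → ℝ) : ℝ := ∫ x, a x * b x

open scoped Classical in
/-- The finite set `{X_1, …, X_n}` of the entries of a tuple. -/
def tupleSet {n : ℕ} (X : Fin n → α) : Finset α := Finset.univ.image X

/-- The set integral `∫ π(𝐗) δ𝐗 = ∑_n (1 / n!) ∫ π({X_1, …, X_n}) dX_{1:n}`. -/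
def setIntegral [MeasureSpace α] (π : Finset α → ℝ) : ℝ :=
  ∑' n : ℕ, (1 / (n.factorial : ℝ)) * ∫ X : Fin n → α, π (tupleSet X)

/-- The integrals and the series (of absolute values) in the set integral converge. -/
def SetIntegrable [MeasureSpace α] (π : Finset α → ℝ) : Prop :=
  (∀ n : ℕ, Integrable (fun X : Fin n → α => π (tupleSet X))) ∧
    Summable fun n : ℕ => (1 / (n.factorial : ℝ)) * ∫ X : Fin n → α, |π (tupleSet X)|

/-- Equality of two functions of a finite set, up to a null set of tuples for every cardinality:
such functions have the same set integral over every region. -/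
def SetAEEq [MeasureSpace α] (f g : Finset α → ℝ) : Prop :=
  ∀ n : ℕ, ∀ᵐ X : Fin n → α, f (tupleSet X) = g (tupleSet X)

open scoped Classical in
/-- All ways to write `S` as a disjoint union of possibly empty sets `P i`, `i : ι`. -/
def splits (ι : Type*) [Fintype ι] (S : Finset α) : Finset (ι → Finset α) :=
  (Fintype.piFinset fun _ : ι => S.powerset).filter fun P =>
    (∀ i j, i ≠ j → Disjoint (P i) (P j)) ∧ Finset.univ.biUnion P = S

/-- The density of a Poisson random finite set with the given intensity. -/
def poissonDensity [MeasureSpace α] (intensity : α → ℝ) (S : Finset α) : ℝ :=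
  Real.exp (-∫ x, intensity x) * ∏ x ∈ S, intensity x

/-- The density of a Bernoulli random finite set with probability of existence `r` and
single-object density `p`: `1 - r` at `∅`, `r * p x` at `{x}`, and `0` otherwise. -/
def bernoulliDensity (r : ℝ) (p : α → ℝ) (S : Finset α) : ℝ :=
  if S.card = 0 then 1 - r else if S.card = 1 then r * ∏ x ∈ S, p x else 0

/-- The parameters of a Poisson multi-Bernoulli with `n` Bernoulli components. -/
structure PMB (α : Type*) [MeasureSpace α] (n : ℕ) where
  /-- intensity of the Poisson component -/
  intensity : α → ℝ
  /-- probabilities of existence -/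
  r : Fin n → ℝ
  /-- single-object densities -/
  p : Fin n → α → ℝ
  intensity_measurable : Measurable intensity
  intensity_nonneg : ∀ x, 0 ≤ intensity x
  intensity_integrable : Integrable intensity
  r_nonneg : ∀ i, 0 ≤ r i
  r_le_one : ∀ i, r i ≤ 1
  p_density : ∀ i, IsDensity (p i)

/-- The multiobject density of a Poisson multi-Bernoulli: the sum over all
`𝐗¹ ⊎ … ⊎ 𝐗ⁿ ⊎ 𝐘 = S`, where `𝐘 = P none` and `𝐗ⁱ = P (some i)`. -/
def PMB.density [MeasureSpace α] {n : ℕ} (f : PMB α n) (S : Finset α) : ℝ :=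
  ∑ P ∈ splits (Option (Fin n)) S,
    poissonDensity f.intensity (P none) *
      ∏ i : Fin n, bernoulliDensity (f.r i) (f.p i) (P (some i))

/-- The parameters of a Poisson multi-Bernoulli mixture whose Bernoulli components are indexed by
`ι` and whose local hypotheses for component `i` are indexed by `H i`. -/
structure PMBM (α : Type*) (ι : Type) (H : ι → Type) where
  /-- intensity of the Poisson component -/
  intensity : α → ℝ
  /-- weights of the local hypotheses -/
  w : ∀ i, H i → ℝ
  /-- probabilities of existence under the local hypotheses -/
  r : ∀ i, H i → ℝ
  /-- single-object densities under the local hypotheses -/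
  p : ∀ i, H i → α → ℝ
  /-- the set of global hypotheses -/
  hyps : Finset (∀ i, H i)

namespace PMBM

variable {ι : Type} [Fintype ι] {H : ι → Type}

/-- The weight of a global hypothesis, normalised over all global hypotheses. -/
def globalWeight (f : PMBM α ι H) (a : ∀ i, H i) : ℝ :=
  (∏ i, f.w i (a i)) / ∑ b ∈ f.hyps, ∏ i, f.w i (b i)

/-- The density of the multi-Bernoulli mixture. -/
def mbmDensity (f : PMBM α ι H) (S : Finset α) : ℝ :=
  ∑ a ∈ f.hyps, f.globalWeight a *
    ∑ P ∈ splits ι S, ∏ i, bernoulliDensity (f.r i (a i)) (f.p i (a i)) (P i)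

open scoped Classical in
/-- The multiobject density of the mixture: the sum over all `𝐘 ⊎ 𝐖 = S` of the Poisson density
of `𝐘` times the multi-Bernoulli mixture density of `𝐖`. -/
def density [MeasureSpace α] (f : PMBM α ι H) (S : Finset α) : ℝ :=
  ∑ W ∈ S.powerset, poissonDensity f.intensity (S \ W) * f.mbmDensity W

/-- The parameters define a Poisson multi-Bernoulli mixture. A local hypothesis of weight zero, or
with probability of existence zero, needs no single-object density. -/
structure IsValid [MeasureSpace α] (f : PMBM α ι H) : Prop where
  intensity_measurable : Measurable f.intensity
  intensity_nonneg : ∀ x, 0 ≤ f.intensity x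
  intensity_integrable : Integrable f.intensity
  w_nonneg : ∀ i a, 0 ≤ f.w i a
  r_nonneg : ∀ i a, 0 ≤ f.r i a
  r_le_one : ∀ i a, f.r i a ≤ 1
  p_density : ∀ i a, f.w i a ≠ 0 → f.r i a ≠ 0 → IsDensity (f.p i a)
  total_pos : 0 < ∑ b ∈ f.hyps, ∏ i, f.w i (b i)

end PMBM

end RandomFiniteSets

/-! The point-target measurement model and Bayes' rule. -/

/-- The standard point-target measurement model with states in `ℝ^nx` and measurements in
`ℝ^nz`. -/
structure MeasurementModel (nx nz : ℕ) where
  /-- probability of detection of a target state -/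
  pD : (Fin nx → ℝ) → ℝ
  /-- `l z x` is the density at `z` of a measurement of the target state `x` -/
  l : (Fin nz → ℝ) → (Fin nx → ℝ) → ℝ
  /-- intensity of the Poisson clutter -/
  clutter : (Fin nz → ℝ) → ℝ
  pD_measurable : Measurable pD
  pD_nonneg : ∀ x, 0 ≤ pD x
  pD_le_one : ∀ x, pD x ≤ 1
  l_measurable : Measurable (Function.uncurry l)
  l_density : ∀ x, IsDensity fun z => l z x
  clutter_measurable : Measurable clutter
  clutter_nonneg : ∀ z, 0 ≤ clutter z
  clutter_integrable : Integrable clutter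

namespace MeasurementModel

variable {k nx nz : ℕ} (M : MeasurementModel nx nz)

open scoped Classical in
/-- The probability of detection of a trajectory: that of its last state if the trajectory is
alive at time step `k`, and zero otherwise. -/
def trajPD (X : Trajectory k nx) : ℝ := if X.IsAlive then M.pD X.last else 0

/-- The density at `z` of a measurement of a trajectory, which depends on its last state. -/
def trajL (z : Fin nz → ℝ) (X : Trajectory k nx) : ℝ := M.l z X.last

/-- The density at the measurement set `z` given the set `S` of trajectories. The measurement set
is the disjoint union of independent random finite sets: Poisson clutter (`P none`), and for every
trajectory `X ∈ S` a set `P (some X)` that has at most one element, is nonempty with probability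
`p^D(X)`, and whose element then has density `l(· | X)`. -/
def likelihood (z : Finset (Fin nz → ℝ)) (S : Finset (Trajectory k nx)) : ℝ :=
  ∑ P ∈ splits (Option {X // X ∈ S}) z,
    poissonDensity M.clutter (P none) *
      ∏ X : {X // X ∈ S},
        bernoulliDensity (M.trajPD X.1) (fun y => M.trajL y X.1) (P (some X))

/-- The normalising constant of Bayes' rule: the density of the measurement set `z` when the set
of trajectories has density `f`. -/
def evidence (f : Finset (Trajectory k nx) → ℝ) (z : Finset (Fin nz → ℝ)) : ℝ :=
  setIntegral fun S => M.likelihood z S * f S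

/-- Bayes' rule: the density of the set of trajectories given the measurement set `z`, for a prior
density `f`. -/
def posterior (f : Finset (Trajectory k nx) → ℝ) (z : Finset (Fin nz → ℝ))
    (S : Finset (Trajectory k nx)) : ℝ :=
  M.likelihood z S * f S / M.evidence f z

end MeasurementModel

/-! The parameters of the updated density. -/

/-- The local hypotheses after an update of `n` Bernoulli components with `m` measurements.
For an old component `inl i`: misdetection `none`, or detection `some j` by the `j`-th measurement.
For the new component `inr j`: `false` (it does not exist), or `true` (it is created by the
`j`-th measurement). -/
def LocalHyp (n m : ℕ) : Fin n ⊕ Fin m → Type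
  | .inl _ => Option (Fin m)
  | .inr _ => Bool

instance {n m : ℕ} : ∀ i, Fintype (LocalHyp n m i)
  | .inl _ => inferInstanceAs (Fintype (Option (Fin m)))
  | .inr _ => inferInstanceAs (Fintype Bool)

/-- The set of the measurement indices that a local hypothesis uses. -/
def measIndices {n m : ℕ} : ∀ i, LocalHyp n m i → Finset (Fin m)
  | .inl _, none => ∅
  | .inl _, some j => {j}
  | .inr _, false => ∅
  | .inr j, true => {j}

/-- The global hypotheses: every measurement is used, and no measurement is used twice. -/
def globalHyps (n m : ℕ) : Finset (∀ i, LocalHyp n m i) :=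
  Finset.univ.filter fun a =>
    (Finset.univ.biUnion fun i => measIndices i (a i)) = Finset.univ ∧
      ∀ i i', i ≠ i' → Disjoint (measIndices i (a i)) (measIndices i' (a i'))

variable {k nx nz n m : ℕ}

/-- The weights of the local hypotheses. -/
def updateW (M : MeasurementModel nx nz) (f : PMB (Trajectory k nx) n)
    (z : Fin m → Fin nz → ℝ) : ∀ i, LocalHyp n m i → ℝ
  | .inl i, none => 1 - f.r i * inn (f.p i) M.trajPD
  | .inl i, some j => f.r i * inn (f.p i) fun X => M.trajL (z j) X * M.trajPD X
  | .inr _, false => 1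
  | .inr j, true =>
      M.clutter (z j) + inn f.intensity fun X => M.trajL (z j) X * M.trajPD X

/-- The probabilities of existence under the local hypotheses. -/
def updateR (M : MeasurementModel nx nz) (f : PMB (Trajectory k nx) n)
    (z : Fin m → Fin nz → ℝ) : ∀ i, LocalHyp n m i → ℝ
  | .inl i, none =>
      f.r i * (inn (f.p i) fun X => 1 - M.trajPD X) / (1 - f.r i * inn (f.p i) M.trajPD)
  | .inl _, some _ => 1
  | .inr _, false => 0
  | .inr j, true =>
      (inn f.intensity fun X => M.trajL (z j) X * M.trajPD X) /
        (M.clutter (z j) + inn f.intensity fun X => M.trajL (z j) X * M.trajPD X)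

/-- The single-trajectory densities under the local hypotheses. The density is irrelevant, and set
to zero, for a new component that does not exist. -/
def updateP (M : MeasurementModel nx nz) (f : PMB (Trajectory k nx) n)
    (z : Fin m → Fin nz → ℝ) : ∀ i, LocalHyp n m i → Trajectory k nx → ℝ
  | .inl i, none => fun X =>
      (1 - M.trajPD X) * f.p i X / inn (f.p i) fun X => 1 - M.trajPD X
  | .inl i, some j => fun X =>
      M.trajL (z j) X * M.trajPD X * f.p i X /
        inn (f.p i) fun X => M.trajL (z j) X * M.trajPD X
  | .inr _, false => fun _ => 0
  | .inr j, true => fun X =>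
      M.trajL (z j) X * M.trajPD X * f.intensity X /
        inn f.intensity fun X => M.trajL (z j) X * M.trajPD X

/-- The parameters of the Poisson multi-Bernoulli mixture that results from the update. -/
def update (M : MeasurementModel nx nz) (f : PMB (Trajectory k nx) n)
    (z : Fin m → Fin nz → ℝ) : PMBM (Trajectory k nx) (Fin n ⊕ Fin m) (LocalHyp n m) where
  intensity := fun X => (1 - M.trajPD X) * f.intensity X
  w := updateW M f z
  r := updateR M f z
  p := updateP M f z
  hyps := globalHyps n m

/-- The normalising integral of every single-trajectory density of the update is nonzero, unless
the function to be normalised vanishes identically. -/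
def NonDegenerate (M : MeasurementModel nx nz) (f : PMB (Trajectory k nx) n)
    (z : Fin m → Fin nz → ℝ) : Prop :=
  (∀ i, (inn (f.p i) fun X => 1 - M.trajPD X) = 0 → ∀ X, (1 - M.trajPD X) * f.p i X = 0) ∧
  (∀ i j, (inn (f.p i) fun X => M.trajL (z j) X * M.trajPD X) = 0 →
    ∀ X, M.trajL (z j) X * M.trajPD X * f.p i X = 0) ∧
  (∀ j, (inn f.intensity fun X => M.trajL (z j) X * M.trajPD X) = 0 →
    ∀ X, M.trajL (z j) X * M.trajPD X * f.intensity X = 0)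

end

end TPMB

/-!
Functions of a finite set form a commutative semiring under the convolution
`(φ * ψ) S = ∑_{A ⊎ B = S} φ A * ψ B`, and a sum over all splits of `S` is a value of a product in
it. Poisson densities are multiples of multiplicative functions `power a : S ↦ ∏_{x ∈ S} a x`, with
`power (a + b) = power a * power b`, and Bernoulli densities are sums of a scalar and a function
`sing a` supported on singletons, so the prior is an explicit product.

The likelihood is treated as a function of the trajectories whose values lie in the semiring `R` of
functions of the set of measurement indices. Write `t_j` for the indicator of `{j}`, so that
`t_j ^ 2 = 0` in `R`. With values in `R`, the likelihood is multiplicative in the set `S` of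
trajectories: it is a constant `e^{-∫λC} ∏_j (1 + λC(z_j) t_j)` times `∏_{X ∈ S} c X`, where
`c X = (1 - pD X) + ∑_j l(z_j | X) pD X t_j`. The actual likelihood is its coefficient of
`∏_j t_j` (`MeasurementModel.likelihood_eq`). Pointwise multiplication by `S ↦ ∏_{X ∈ S} c X`
respects convolution (`SetFun.twist`), so it can be carried out in each factor of the prior. A
Bernoulli factor becomes the sum of its weighted local hypotheses, each times the product of the
`t_j` that it uses (`twist_bernoulli`). The Poisson factor `power (c * λ)` splits into the
undetected Poisson part and factors `power (g_j t_j) = 1 + t_j * sing g_j`, with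
`g_j = l(z_j | ·) pD λ`, which combine with the clutter factors `1 + λC(z_j) t_j` into the new
components (`twist_poisson`). Expanding the product and taking the coefficient of `∏_j t_j` leaves
exactly the global hypotheses: they are the choices in which every measurement index is used exactly
once (`likelihood_mul_density`).

The set integral of such a product is the product of the set integrals of its factors
(`SetFun.HasSetIntegral.mul_prod`), since almost all tuples of trajectories have distinct entries;
this evaluates the evidence. Normalising the weighted hypotheses gives the stated parameters, except
at trajectories where a numerator is nonzero over a vanishing integral; these form a null set.
-/

namespace TPMB

noncomputable section

/-! ### The convolution semiring of set functions -/

/-- Functions of a finite set, with values in `R`. They form a commutative semiring under pointwise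
addition and the convolution `(φ * ψ) S = ∑_{A ⊎ B = S} φ A * ψ B`. -/
structure SetFun (α R : Type*) where
  /-- The underlying function. -/
  toFun : Finset α → R

namespace SetFun

variable {α β R T : Type*}

instance : CoeFun (SetFun α R) fun _ => Finset α → R := ⟨toFun⟩

@[simp] theorem mk_apply (φ : Finset α → R) (S : Finset α) : (⟨φ⟩ : SetFun α R) S = φ S := rfl

@[ext] theorem ext {φ ψ : SetFun α R} (h : ∀ S : Finset α, φ S = ψ S) : φ = ψ := by
  cases φ; cases ψ; congr; exact funext h

variable [CommSemiring R] [CommSemiring T]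

instance : Zero (SetFun α R) := ⟨⟨fun _ => 0⟩⟩

instance : Add (SetFun α R) := ⟨fun φ ψ => ⟨fun S => φ S + ψ S⟩⟩

theorem add_apply (φ ψ : SetFun α R) (S : Finset α) : (φ + ψ) S = φ S + ψ S := rfl

theorem zero_apply (S : Finset α) : (0 : SetFun α R) S = 0 := rfl

/-- The indicator of the finite set `M`. -/
def ind (R : Type*) [CommSemiring R] (M : Finset α) : SetFun α R := by
  classical exact ⟨fun S => if S = M then 1 else 0⟩

instance : One (SetFun α R) := ⟨ind R ∅⟩

open scoped Classical in
instance : Mul (SetFun α R) := ⟨fun φ ψ => ⟨fun S => ∑ A ∈ S.powerset, φ A * ψ (S \ A)⟩⟩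

open scoped Classical in
theorem mul_apply (φ ψ : SetFun α R) (S : Finset α) :
    (φ * ψ) S = ∑ A ∈ S.powerset, φ A * ψ (S \ A) := rfl

open scoped Classical in
theorem ind_apply (M S : Finset α) : ind R M S = if S = M then 1 else 0 := by
  simp only [ind, mk_apply]

theorem ind_empty : ind R (∅ : Finset α) = 1 := rfl

open scoped Classical in
theorem one_apply (S : Finset α) : (1 : SetFun α R) S = if S = ∅ then 1 else 0 := ind_apply ∅ S

protected theorem mul_comm (φ ψ : SetFun α R) : φ * ψ = ψ * φ := by
  classical
  ext S
  simp only [mul_apply]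
  refine Finset.sum_nbij' (fun A => S \ A) (fun A => S \ A) ?_ ?_ ?_ ?_ ?_
  · intro A _; simp
  · intro A _; simp
  · intro A hA; simpa using hA
  · intro A hA; simpa using hA
  · intro A hA
    rw [Finset.sdiff_sdiff_eq_self (Finset.mem_powerset.1 hA), mul_comm]

protected theorem mul_assoc (φ ψ χ : SetFun α R) : φ * ψ * χ = φ * (ψ * χ) := by
  classical
  ext S
  simp only [mul_apply, Finset.sum_mul, Finset.mul_sum, Finset.sum_sigma']
  refine Finset.sum_nbij' (fun p => ⟨p.2, p.1 \ p.2⟩) (fun p => ⟨p.1 ∪ p.2, p.1⟩) ?_ ?_ ?_ ?_ ?_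
  · rintro ⟨A, B⟩ h
    simp only [Finset.mem_sigma, Finset.mem_powerset] at h ⊢
    exact ⟨h.2.trans h.1, Finset.sdiff_subset_sdiff h.1 le_rfl⟩
  · rintro ⟨A, B⟩ h
    simp only [Finset.mem_sigma, Finset.mem_powerset] at h ⊢
    exact ⟨Finset.union_subset h.1 (h.2.trans Finset.sdiff_subset), Finset.subset_union_left⟩
  · rintro ⟨A, B⟩ h
    simp only [Finset.mem_sigma, Finset.mem_powerset] at h ⊢
    rw [Finset.union_sdiff_of_subset h.2]
  · rintro ⟨A, B⟩ h
    simp only [Finset.mem_sigma, Finset.mem_powerset] at h ⊢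
    rw [Finset.union_sdiff_cancel_left]
    exact (Finset.disjoint_sdiff).mono_right h.2
  · rintro ⟨A, B⟩ h
    simp only [Finset.mem_sigma, Finset.mem_powerset] at h ⊢
    have : (S \ B) \ (A \ B) = S \ A := by
      ext x
      have := @h.2 x
      simp only [Finset.mem_sdiff]
      tauto
    rw [this, mul_assoc]

protected theorem one_mul (φ : SetFun α R) : 1 * φ = φ := by
  classical
  ext S
  simp [mul_apply, one_apply, ite_mul]

instance : CommSemiring (SetFun α R) where
  add_assoc φ ψ χ := by ext S; simp only [add_apply, add_assoc]
  zero_add φ := by ext S; simp only [add_apply, zero_apply, zero_add]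
  add_zero φ := by ext S; simp only [add_apply, zero_apply, add_zero]
  add_comm φ ψ := by ext S; simp only [add_apply, add_comm]
  nsmul := nsmulRec
  mul_assoc := SetFun.mul_assoc
  mul_comm := SetFun.mul_comm
  one_mul := SetFun.one_mul
  mul_one φ := by rw [SetFun.mul_comm, SetFun.one_mul]
  zero_mul φ := by ext S; simp [mul_apply, zero_apply]
  mul_zero φ := by ext S; simp [mul_apply, zero_apply]
  left_distrib φ ψ χ := by
    ext S; simp [mul_apply, add_apply, mul_add, Finset.sum_add_distrib]
  right_distrib φ ψ χ := by
    ext S; simp [mul_apply, add_apply, add_mul, Finset.sum_add_distrib]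

theorem sum_apply {ι : Type*} (s : Finset ι) (φ : ι → SetFun α R) (S : Finset α) :
    (∑ i ∈ s, φ i) S = ∑ i ∈ s, φ i S := by
  classical
  induction s using Finset.induction_on with
  | empty => rfl
  | insert i s hi ih => rw [Finset.sum_insert hi, Finset.sum_insert hi, add_apply, ih]

/-! ### Products of finitely many set functions -/

theorem mem_splits {ι : Type*} [Fintype ι] {S : Finset α} {P : ι → Finset α} :
    P ∈ splits ι S ↔ (∀ i j, i ≠ j → Disjoint (P i) (P j)) ∧ ∀ x, x ∈ S ↔ ∃ i, x ∈ P i := by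
  classical
  simp only [splits, Finset.mem_filter, Fintype.mem_piFinset, Finset.mem_powerset]
  constructor
  · rintro ⟨_, h, rfl⟩
    exact ⟨h, fun x => by simp⟩
  · rintro ⟨h, h2⟩
    exact ⟨fun i x hx => (h2 x).2 ⟨i, hx⟩, h, by ext x; simp [h2]⟩

/-- The sum over all splits of a set into parts indexed by `ι` is the value of a convolution
product. -/
theorem prod_apply {ι : Type*} [Fintype ι] (φ : ι → SetFun α R) (S : Finset α) :
    (∏ i, φ i) S = ∑ P ∈ splits ι S, ∏ i, φ i (P i) := by
  classical
  revert φ S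
  refine Fintype.induction_empty_option (P := fun ι _ => ∀ (φ : ι → SetFun α R) (S : Finset α),
    (∏ i, φ i) S = ∑ P ∈ splits ι S, ∏ i, φ i (P i)) ?_ ?_ ?_ ι
  · intro ι κ _ e ih φ S
    let _ := Fintype.ofEquiv κ e.symm
    rw [← e.prod_comp φ, ih (fun i => φ (e i)) S]
    refine Finset.sum_nbij' (fun P => fun k => P (e.symm k)) (fun P => fun i => P (e i)) ?_ ?_ ?_ ?_ ?_
    · intro P hP
      rw [mem_splits] at hP ⊢
      refine ⟨fun i j hij => hP.1 _ _ (by simpa using hij), fun x => ?_⟩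
      rw [hP.2, e.symm.surjective.exists]
    · intro P hP
      rw [mem_splits] at hP ⊢
      refine ⟨fun i j hij => hP.1 _ _ (by simpa using hij), fun x => ?_⟩
      rw [hP.2, e.surjective.exists]
    · intro P _; simp
    · intro P _; simp
    · intro P _
      rw [← e.prod_comp (fun k => φ k (P (e.symm k)))]
      simp
  · intro φ S
    have : splits PEmpty S = if S = ∅ then {fun i => i.elim} else ∅ := by
      ext P
      rw [mem_splits]
      split_ifs with h
      · simp [h, funext_iff]
      · simpa [Finset.eq_empty_iff_forall_notMem] using h
    rw [this]
    simp only [Finset.univ_eq_empty, Finset.prod_empty, one_apply]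
    split_ifs <;> simp
  · intro ι _ ih φ S
    rw [Fintype.prod_option, mul_apply]
    simp only [ih, Finset.mul_sum, Finset.sum_sigma', Fintype.prod_option]
    refine Finset.sum_nbij' (fun p => fun o => Option.elim o p.1 p.2)
      (fun P => ⟨P none, fun i => P (some i)⟩) ?_ ?_ ?_ ?_ ?_
    · rintro ⟨A, P⟩ h
      simp only [Finset.mem_sigma, Finset.mem_powerset, mem_splits] at h ⊢
      obtain ⟨hA, hd, hS⟩ := h
      have key : ∀ i, Disjoint A (P i) := fun i => by
        refine Finset.disjoint_left.2 fun x hxA hx => ?_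
        have := (hS x).2 ⟨i, hx⟩
        simp [hxA] at this
      refine ⟨?_, fun x => ?_⟩
      · rintro (_ | i) (_ | j) hij
        · exact absurd rfl hij
        · exact key j
        · exact (key i).symm
        · exact hd i j (by simpa using hij)
      · rw [Option.exists]
        simp only [Option.elim]
        rw [← hS, Finset.mem_sdiff]
        have := @hA x
        tauto
    · intro P h
      simp only [Finset.mem_sigma, Finset.mem_powerset, mem_splits] at h ⊢
      obtain ⟨hd, hS⟩ := h
      refine ⟨fun x hx => (hS x).2 ⟨none, hx⟩, fun i j hij => hd _ _ (by simpa using hij),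
        fun x => ?_⟩
      rw [Finset.mem_sdiff, hS, Option.exists]
      constructor
      · rintro ⟨h1 | h1, h2⟩
        · exact absurd h1 h2
        · exact h1
      · rintro ⟨i, hi⟩
        exact ⟨Or.inr ⟨i, hi⟩, fun h0 => Finset.disjoint_left.1 (hd none (some i) (by simp)) h0 hi⟩
    · rintro ⟨A, P⟩ _; rfl
    · intro P _
      funext o
      cases o <;> rfl
    · rintro ⟨A, P⟩ _; rfl

open scoped Classical in
theorem prod_ind_apply {ι : Type*} [Fintype ι] (M : ι → Finset α) (S : Finset α) :
    (∏ i, ind R (M i)) S = if M ∈ splits ι S then 1 else 0 := by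
  rw [prod_apply]
  have : ∀ P : ι → Finset α, ∏ i, ind R (M i) (P i) = if P = M then 1 else 0 := by
    intro P
    split_ifs with h
    · simp [h, ind_apply]
    · obtain ⟨i, hi⟩ := Function.ne_iff.1 h
      exact Finset.prod_eq_zero (Finset.mem_univ i) (by simp [ind_apply, hi])
  simp [this]

theorem ind_singleton_mul_self (x : α) : ind R {x} * ind R {x} = 0 := by
  classical
  ext S
  simp only [mul_apply, zero_apply]
  refine Finset.sum_eq_zero fun A _ => ?_
  simp only [ind_apply]
  split_ifs with h1 h2
  · have : x ∈ S \ A := by simp [h2]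
    simp [h1] at this
  all_goals simp

/-! ### Ring homomorphisms -/

open scoped Classical in
/-- The scalars: `C r` is `r` at `∅`, and zero elsewhere. -/
def C : R →+* SetFun α R where
  toFun r := ⟨fun S => if S = ∅ then r else 0⟩
  map_zero' := by ext S; simp [zero_apply]
  map_one' := by ext S; simp [one_apply]
  map_add' a b := by ext S; simp only [add_apply]; split_ifs <;> simp
  map_mul' a b := by
    ext S
    simp only [mul_apply, ite_mul, zero_mul]
    simp

open scoped Classical in
theorem C_apply (r : R) (S : Finset α) : C r S = if S = ∅ then r else 0 := rfl

@[simp] theorem C_mul_apply (r : R) (φ : SetFun α R) (S : Finset α) :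
    (C r * φ : SetFun α R) S = r * φ S := by
  classical
  simp [mul_apply, C_apply, ite_mul]

/-- Applying a ring homomorphism to the values. -/
def map (g : R →+* T) : SetFun α R →+* SetFun α T where
  toFun φ := ⟨fun S => g (φ S)⟩
  map_zero' := by ext S; simp [zero_apply]
  map_one' := by classical ext S; simp [one_apply, apply_ite g]
  map_add' φ ψ := by ext S; simp [add_apply]
  map_mul' φ ψ := by classical ext S; simp [mul_apply]

theorem map_apply (g : R →+* T) (φ : SetFun α R) (S : Finset α) : map g φ S = g (φ S) := rfl

theorem map_C (g : R →+* T) (r : R) : map g (C r : SetFun α R) = C (g r) := by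
  classical
  ext S; simp [map_apply, C_apply, apply_ite g]

/-- Multiplying pointwise by the multiplicative function `S ↦ ∏_{x ∈ S} c x`. This respects
convolution. -/
def twist (c : α → R) : SetFun α R →+* SetFun α R where
  toFun φ := ⟨fun S => (∏ x ∈ S, c x) * φ S⟩
  map_zero' := by ext S; simp [zero_apply]
  map_one' := by
    classical
    ext S
    simp only [one_apply]
    split_ifs with h <;> simp [h]
  map_add' φ ψ := by ext S; simp [add_apply, mul_add]
  map_mul' φ ψ := by
    classical
    ext S
    simp only [mul_apply, Finset.mul_sum]
    refine Finset.sum_congr rfl fun A hA => ?_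
    rw [← Finset.prod_sdiff (Finset.mem_powerset.1 hA)]
    ring

theorem twist_apply (c : α → R) (φ : SetFun α R) (S : Finset α) :
    twist c φ S = (∏ x ∈ S, c x) * φ S := rfl

theorem twist_C (c : α → R) (r : R) : twist c (C r) = C r := by
  classical
  ext S
  simp only [twist_apply, C_apply]
  split_ifs with h <;> simp [h]

/-- Restriction along an injection `e`: the function `S ↦ φ (e '' S)`. -/
def comap (e : β ↪ α) : SetFun α R →+* SetFun β R where
  toFun φ := ⟨fun S => φ (S.map e)⟩
  map_zero' := rfl
  map_one' := by classical ext S; simp [one_apply]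
  map_add' φ ψ := rfl
  map_mul' φ ψ := by
    classical
    ext S
    simp only [mul_apply]
    symm
    refine Finset.sum_bij (fun A _ => A.map e) ?_ ?_ ?_ ?_
    · intro A hA; simpa using hA
    · intro A _ B _ h; exact Finset.map_injective e h
    · intro B hB
      obtain ⟨A, hA, rfl⟩ := Finset.subset_map_iff.1 (Finset.mem_powerset.1 hB)
      exact ⟨A, Finset.mem_powerset.2 hA, rfl⟩
    · intro A _; simp only [Finset.map_sdiff]

theorem comap_apply (e : β ↪ α) (φ : SetFun α R) (S : Finset β) :
    comap e φ S = φ (S.map e) := rfl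

/-! ### Poisson and Bernoulli set functions -/

/-- The multiplicative function `S ↦ ∏_{x ∈ S} a x`. -/
def power (a : α → R) : SetFun α R := ⟨fun S => ∏ x ∈ S, a x⟩

theorem power_apply (a : α → R) (S : Finset α) : power a S = ∏ x ∈ S, a x := rfl

/-- The function that is `a x` at `{x}`, and zero at the sets that are not singletons. -/
def sing (a : α → R) : SetFun α R :=
  ⟨fun S => if S.card = 1 then ∏ x ∈ S, a x else 0⟩

theorem sing_apply (a : α → R) (S : Finset α) :
    sing a S = if S.card = 1 then ∏ x ∈ S, a x else 0 := rfl

theorem sing_add (a b : α → R) : sing (a + b) = sing a + sing b := by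
  ext S
  simp only [sing_apply, add_apply]
  split_ifs with h
  · obtain ⟨x, rfl⟩ := Finset.card_eq_one.1 h
    simp
  · simp

theorem sing_zero : sing (0 : α → R) = 0 := by
  ext S
  simp only [sing_apply, zero_apply]
  split_ifs with h
  · obtain ⟨x, rfl⟩ := Finset.card_eq_one.1 h
    simp
  · simp

theorem sing_sum {ι : Type*} (s : Finset ι) (a : ι → α → R) :
    sing (∑ i ∈ s, a i) = ∑ i ∈ s, sing (a i) := by
  classical
  induction s using Finset.induction_on with
  | empty => simp [sing_zero]
  | insert i s hi ih => rw [Finset.sum_insert hi, Finset.sum_insert hi, sing_add, ih]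

theorem sing_const_mul (r : R) (a : α → R) : sing (fun x => r * a x) = C r * sing a := by
  ext S
  rw [C_mul_apply]
  simp only [sing_apply]
  split_ifs with h
  · obtain ⟨x, rfl⟩ := Finset.card_eq_one.1 h
    simp
  · simp

theorem map_sing (g : R →+* T) (a : α → R) : map g (sing a) = sing fun x => g (a x) := by
  ext S
  simp [map_apply, sing_apply, apply_ite g]

theorem map_power (g : R →+* T) (a : α → R) : map g (power a) = power fun x => g (a x) := by
  ext S
  simp [map_apply, power_apply]

theorem twist_sing (c a : α → R) : twist c (sing a) = sing fun x => c x * a x := by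
  ext S
  simp [twist_apply, sing_apply, Finset.prod_mul_distrib]

theorem twist_power (c a : α → R) : twist c (power a) = power fun x => c x * a x := by
  ext S
  simp [twist_apply, power_apply, Finset.prod_mul_distrib]

theorem comap_sing (e : β ↪ α) (a : α → R) : comap e (sing a) = sing fun x => a (e x) := by
  ext S
  simp [comap_apply, sing_apply]

theorem comap_power (e : β ↪ α) (a : α → R) : comap e (power a) = power fun x => a (e x) := by
  ext S
  simp [comap_apply, power_apply]

theorem comap_C (e : β ↪ α) (r : R) : comap e (C r) = C r := by
  classical
  ext S
  simp [comap_apply, C_apply]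

theorem power_add (a b : α → R) : power (a + b) = power a * power b := by
  classical
  ext S
  simp only [power_apply, mul_apply, Pi.add_apply, Finset.prod_add]

theorem power_zero : power (0 : α → R) = 1 := by
  classical
  ext S
  simp only [power_apply, one_apply]
  split_ifs with h
  · simp [h]
  · obtain ⟨x, hx⟩ := Finset.nonempty_iff_ne_empty.2 h
    exact Finset.prod_eq_zero hx rfl

theorem power_sum {ι : Type*} (s : Finset ι) (a : ι → α → R) :
    power (∑ i ∈ s, a i) = ∏ i ∈ s, power (a i) := by
  classical
  induction s using Finset.induction_on with
  | empty => simp [power_zero]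
  | insert i s hi ih => rw [Finset.sum_insert hi, Finset.prod_insert hi, power_add, ih]

/-- A multiplicative function stops after its linear term if its factors annihilate each other. -/
theorem power_eq_one_add_sing (a : α → R) (h : ∀ x y, x ≠ y → a x * a y = 0) :
    power a = 1 + sing a := by
  classical
  ext S
  simp only [power_apply, add_apply, one_apply, sing_apply]
  rcases Nat.lt_or_ge 1 S.card with h1 | h1
  · obtain ⟨x, hx, y, hy, hxy⟩ := Finset.one_lt_card.1 h1
    have hS : S ≠ ∅ := Finset.ne_empty_of_mem hx
    rw [if_neg hS, if_neg (by omega), ← Finset.mul_prod_erase S a hx,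
      ← Finset.mul_prod_erase (S.erase x) a (Finset.mem_erase.2 ⟨hxy.symm, hy⟩), ← mul_assoc,
      h x y hxy]
    simp
  · rcases Nat.le_one_iff_eq_zero_or_eq_one.1 h1 with h0 | h0
    · rw [Finset.card_eq_zero] at h0
      simp [h0]
    · have hS : S ≠ ∅ := by rintro rfl; simp at h0
      simp [h0, hS]

open scoped Classical in
theorem sing_single (x : α) (r : R) : sing (Pi.single x r) = C r * ind R {x} := by
  ext S
  rw [C_mul_apply]
  simp only [sing_apply, ind_apply]
  split_ifs with h1 h2 h2
  · simp [h2]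
  · obtain ⟨y, rfl⟩ := Finset.card_eq_one.1 h1
    have : y ≠ x := by simpa using h2
    simp [this]
  · simp [h2] at h1
  · simp

theorem sing_eq_sum [Fintype α] (a : α → R) : sing a = ∑ x, C (a x) * ind R {x} := by
  classical
  conv_lhs => rw [← Finset.univ_sum_single a]
  rw [sing_sum]
  simp [sing_single]

theorem power_eq_prod [Fintype α] (a : α → R) : power a = ∏ x, (1 + C (a x) * ind R {x}) := by
  classical
  conv_lhs => rw [← Finset.univ_sum_single a]
  rw [power_sum]
  refine Finset.prod_congr rfl fun x _ => ?_
  rw [power_eq_one_add_sing, sing_single]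
  intro y z hyz
  by_cases h : y = x
  · have : z ≠ x := fun h' => hyz (h.trans h'.symm)
    simp [Pi.single_eq_of_ne this]
  · simp [Pi.single_eq_of_ne h]

theorem poissonDensity_eq [MeasureSpace α] (a : α → ℝ) :
    (⟨poissonDensity a⟩ : SetFun α ℝ) = C (Real.exp (-∫ x, a x)) * power a := by
  ext S
  rw [C_mul_apply]
  rfl

theorem bernoulliDensity_eq (r : ℝ) (p : α → ℝ) :
    (⟨bernoulliDensity r p⟩ : SetFun α ℝ) = C (1 - r) + sing fun x => r * p x := by
  classical
  ext S
  rw [sing_const_mul]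
  rw [add_apply, C_mul_apply]
  simp only [bernoulliDensity, C_apply, sing_apply, Finset.card_eq_zero]
  split_ifs with h1 h2
  · simp [h1] at h2
  · simp
  · simp
  · simp

end SetFun

/-! ### Set integrals of convolution products -/

namespace SetFun

variable {α : Type*}

open scoped Classical in
theorem sing_mul_apply {R : Type*} [CommSemiring R] (a : α → R) (φ : SetFun α R) (S : Finset α) :
    (sing a * φ : SetFun α R) S = ∑ x ∈ S, a x * φ (S.erase x) := by
  rw [mul_apply]
  simp only [sing_apply, ite_mul, zero_mul]
  rw [← Finset.sum_filter]
  symm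
  refine Finset.sum_bij (fun x _ => {x}) ?_ ?_ ?_ ?_
  · intro x hx; simpa using hx
  · intro x _ y _ h; simpa using h
  · intro A hA
    simp only [Finset.mem_filter, Finset.mem_powerset] at hA
    obtain ⟨x, rfl⟩ := Finset.card_eq_one.1 hA.2
    exact ⟨x, by simpa using hA.1, rfl⟩
  · intro x _
    simp [Finset.sdiff_singleton_eq_erase]

theorem tupleSet_eq_image [DecidableEq α] {n : ℕ} (X : Fin n → α) :
    tupleSet X = Finset.univ.image X := by
  ext; simp [tupleSet]

theorem sing_mul_tupleSet {R : Type*} [CommSemiring R] (a : α → R) (φ : SetFun α R) {n : ℕ}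
    (X : Fin (n + 1) → α) (hX : Function.Injective X) :
    (sing a * φ : SetFun α R) (tupleSet X) =
      ∑ i, a (X i) * φ (tupleSet fun j => X (i.succAbove j)) := by
  classical
  rw [sing_mul_apply]
  rw [tupleSet_eq_image, Finset.sum_image fun x _ y _ h => hX h]
  refine Finset.sum_congr rfl fun i _ => ?_
  congr 2
  ext x
  simp only [tupleSet, Finset.mem_erase, Finset.mem_image, Finset.mem_univ, true_and]
  constructor
  · rintro ⟨hx, l, rfl⟩
    obtain ⟨j, rfl⟩ := Fin.exists_succAbove_eq (x := l) (y := i) fun h => hx (h ▸ rfl)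
    exact ⟨j, rfl⟩
  · rintro ⟨j, rfl⟩
    exact ⟨fun h => Fin.succAbove_ne i j (hX h), _, rfl⟩

theorem sing_mul_tupleSet_zero {R : Type*} [CommSemiring R] (a : α → R) (φ : SetFun α R) (X : Fin 0 → α) :
    (sing a * φ : SetFun α R) (tupleSet X) = 0 := by
  classical
  rw [sing_mul_apply]
  simp [tupleSet]

variable [MeasureSpace α]

/-- The set integral of `φ` converges absolutely, with value `c`. -/
def HasSetIntegral (φ : SetFun α ℝ) (c : ℝ) : Prop :=
  SetIntegrable φ.toFun ∧
    HasSum (fun n : ℕ => (1 / (n.factorial : ℝ)) * ∫ X : Fin n → α, φ (tupleSet X)) c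

theorem HasSetIntegral.setIntegral_eq {φ : SetFun α ℝ} {c : ℝ} (h : HasSetIntegral φ c) :
    setIntegral φ.toFun = c := h.2.tsum_eq

theorem HasSetIntegral.zero : HasSetIntegral (0 : SetFun α ℝ) 0 := by
  refine ⟨⟨fun n => ?_, ?_⟩, ?_⟩
  all_goals simp [zero_apply]

theorem HasSetIntegral.add {φ ψ : SetFun α ℝ} {c d : ℝ} (h : HasSetIntegral φ c)
    (h' : HasSetIntegral ψ d) : HasSetIntegral (φ + ψ) (c + d) := by
  refine ⟨⟨fun n => (h.1.1 n).add (h'.1.1 n), ?_⟩, ?_⟩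
  · refine Summable.of_nonneg_of_le (fun n => by positivity) (fun n => ?_) (h.1.2.add h'.1.2)
    rw [← mul_add, ← integral_add (h.1.1 n).abs (h'.1.1 n).abs]
    refine mul_le_mul_of_nonneg_left ?_ (by positivity)
    exact integral_mono ((h.1.1 n).add (h'.1.1 n)).abs ((h.1.1 n).abs.add (h'.1.1 n).abs)
      fun X => abs_add_le _ _
  · convert h.2.add h'.2 using 2 with n
    rw [← mul_add, ← integral_add (h.1.1 n) (h'.1.1 n)]
    rfl

theorem HasSetIntegral.C_mul {φ : SetFun α ℝ} {c : ℝ} (r : ℝ) (h : HasSetIntegral φ c) :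
    HasSetIntegral (C r * φ) (r * c) := by
  refine ⟨⟨fun n => ?_, ?_⟩, ?_⟩
  · simpa using (h.1.1 n).const_mul r
  · simpa [abs_mul, integral_const_mul, mul_left_comm] using h.1.2.mul_left |r|
  · simpa [integral_const_mul, mul_left_comm] using h.2.mul_left r

theorem HasSetIntegral.sum {ι : Type*} (s : Finset ι) {φ : ι → SetFun α ℝ} {c : ι → ℝ}
    (h : ∀ i ∈ s, HasSetIntegral (φ i) (c i)) :
    HasSetIntegral (∑ i ∈ s, φ i) (∑ i ∈ s, c i) := by
  classical
  induction s using Finset.induction_on with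
  | empty => simpa using HasSetIntegral.zero
  | insert i s hi ih =>
    rw [Finset.sum_insert hi, Finset.sum_insert hi]
    exact (h i (by simp)).add (ih fun j hj => h j (by simp [hj]))

variable [SigmaFinite (volume : Measure α)]

/-- The set integral of `power a` is the exponential series. -/
theorem HasSetIntegral.power (hinj : ∀ n, ∀ᵐ X : Fin n → α, Function.Injective X)
    {a : α → ℝ} (ha : Integrable a) : HasSetIntegral (power a) (Real.exp (∫ x, a x)) := by
  have key : ∀ n, (fun X : Fin n → α => SetFun.power a (tupleSet X)) =ᵐ[volume]
      fun X => ∏ i, a (X i) := fun n => by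
    classical
    filter_upwards [hinj n] with X hX
    rw [power_apply, tupleSet_eq_image, Finset.prod_image fun x _ y _ h => hX h]
  have hint : ∀ n, Integrable (fun X : Fin n → α => ∏ i, a (X i)) := fun n =>
    Integrable.fintype_prod (f := fun _ => a) fun _ => ha
  have hexp : ∀ c : ℝ, HasSum (fun n : ℕ => (1 / (n.factorial : ℝ)) * c ^ n) (Real.exp c) := by
    intro c
    rw [Real.exp_eq_exp_ℝ]
    simpa [div_eq_inv_mul] using NormedSpace.expSeries_div_hasSum_exp c
  refine ⟨⟨fun n => (hint n).congr (key n).symm, ?_⟩, ?_⟩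
  · convert (hexp (∫ x, |a x|)).summable using 3 with n
    have key' : (fun X : Fin n → α => |SetFun.power a (tupleSet X)|) =ᵐ[volume]
        fun X => ∏ i, |a (X i)| := by
      filter_upwards [key n] with X hX
      rw [hX, Finset.abs_prod]
    rw [integral_congr_ae key']
    simpa using integral_fintype_prod_volume_eq_pow (ι := Fin n) (fun x => |a x|)
  · convert hexp (∫ x, a x) using 3 with n
    rw [integral_congr_ae (key n)]
    simpa using integral_fintype_prod_volume_eq_pow (ι := Fin n) a

/-- Convolution with `sing a` multiplies the set integral by `∫ a`: each of the `n + 1` entries of a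
tuple can be the one that `sing a` takes, and the other `n` entries are left to `φ`. -/
theorem HasSetIntegral.sing_mul (hinj : ∀ n, ∀ᵐ X : Fin n → α, Function.Injective X)
    {a : α → ℝ} (ha : Integrable a) {φ : SetFun α ℝ} {c : ℝ} (h : HasSetIntegral φ c) :
    HasSetIntegral (sing a * φ) ((∫ x, a x) * c) := by
  have key : ∀ n, (fun X : Fin (n + 1) → α => (sing a * φ : SetFun α ℝ) (tupleSet X)) =ᵐ[volume]
      fun X => ∑ i, a (X i) * φ (tupleSet fun j => X (i.succAbove j)) := fun n => by
    filter_upwards [hinj (n + 1)] with X hX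
    exact sing_mul_tupleSet a φ X hX
  have hpres : ∀ n (i : Fin (n + 1)), MeasurePreserving
      (MeasurableEquiv.piFinSuccAbove (fun _ => α) i) :=
    fun n i => volume_preserving_piFinSuccAbove (fun _ => α) i
  have hint : ∀ n (i : Fin (n + 1)), Integrable fun X : Fin (n + 1) → α =>
      a (X i) * φ (tupleSet fun j => X (i.succAbove j)) := fun n i =>
    (hpres n i).integrable_comp_of_integrable (ha.mul_prod (h.1.1 n))
  have hfub : ∀ n (i : Fin (n + 1)) (b : α → ℝ) (χ : Finset α → ℝ),
      ∫ X : Fin (n + 1) → α, b (X i) * χ (tupleSet fun j => X (i.succAbove j)) =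
        (∫ x, b x) * ∫ Y : Fin n → α, χ (tupleSet Y) := fun n i b χ => by
    rw [← integral_prod_mul b fun Y : Fin n → α => χ (tupleSet Y)]
    exact (hpres n i).integral_comp (MeasurableEquiv.measurableEmbedding _)
      fun p => b p.1 * χ (tupleSet p.2)
  have hfac : ∀ n : ℕ, (1 / ((n + 1).factorial : ℝ)) * (n + 1) = 1 / (n.factorial : ℝ) := by
    intro n
    rw [Nat.factorial_succ]
    push_cast
    field_simp
  have hI : ∀ n, Integrable fun X : Fin n → α => (sing a * φ : SetFun α ℝ) (tupleSet X) := by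
    rintro (_ | n)
    · simp [sing_mul_tupleSet_zero]
    · exact (integrable_finsetSum _ fun i _ => hint n i).congr (key n).symm
  refine ⟨⟨hI, ?_⟩, ?_⟩
  · rw [← summable_nat_add_iff 1]
    refine Summable.of_nonneg_of_le (fun n => by positivity) (fun n => ?_)
      (h.1.2.mul_left (∫ x, |a x|))
    have hle : ∫ X : Fin (n + 1) → α, |(sing a * φ : SetFun α ℝ) (tupleSet X)| ≤
        (n + 1) * ((∫ x, |a x|) * ∫ Y : Fin n → α, |φ (tupleSet Y)|) := by
      calc _ ≤ ∫ X : Fin (n + 1) → α,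
            ∑ i, |a (X i)| * |φ (tupleSet fun j => X (i.succAbove j))| := by
            refine integral_mono_ae (hI _).abs ?_ ?_
            · exact integrable_finsetSum _ fun i _ => by simpa [abs_mul] using (hint n i).abs
            · filter_upwards [key n] with X hX
              rw [hX]
              refine (Finset.abs_sum_le_sum_abs _ _).trans_eq ?_
              simp [abs_mul]
        _ = _ := by
            rw [integral_finsetSum _ fun i _ => by simpa [abs_mul] using (hint n i).abs]
            simp only [hfub n _ (fun x => |a x|) fun S => |φ S|]
            simp
    refine (mul_le_mul_of_nonneg_left hle (by positivity)).trans_eq ?_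
    rw [← mul_assoc, hfac]
    ring
  · rw [← hasSum_nat_add_iff' 1]
    simp only [Finset.range_one, Finset.sum_singleton, sing_mul_tupleSet_zero, integral_zero,
      mul_zero, sub_zero]
    have hterm : ∀ n : ℕ, (1 / ((n + 1).factorial : ℝ)) *
        ∫ X : Fin (n + 1) → α, (sing a * φ : SetFun α ℝ) (tupleSet X) =
        (∫ x, a x) * ((1 / (n.factorial : ℝ)) * ∫ Y : Fin n → α, φ (tupleSet Y)) := fun n => by
      rw [integral_congr_ae (key n), integral_finsetSum _ fun i _ => hint n i]
      simp only [hfub n _ a φ.toFun]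
      simp only [Finset.sum_const, Finset.card_univ, Fintype.card_fin, nsmul_eq_mul]
      push_cast
      rw [← mul_assoc, hfac]
      ring
    simpa only [hterm] using h.2.mul_left (∫ x, a x)

/-- Convolution with finitely many factors that are supported on sets of at most one element. -/
theorem HasSetIntegral.mul_prod (hinj : ∀ n, ∀ᵐ X : Fin n → α, Function.Injective X)
    {ι : Type*} (s : Finset ι) {b : ι → ℝ} {a : ι → α → ℝ} (ha : ∀ i ∈ s, Integrable (a i))
    {φ : SetFun α ℝ} {c : ℝ} (h : HasSetIntegral φ c) :
    HasSetIntegral (φ * ∏ i ∈ s, (C (b i) + sing (a i))) (c * ∏ i ∈ s, (b i + ∫ x, a i x)) := by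
  classical
  induction s using Finset.induction_on with
  | empty => simpa using h
  | insert i s hi ih =>
    rw [Finset.prod_insert hi, Finset.prod_insert hi]
    have h1 := ih fun j hj => ha j (by simp [hj])
    convert (h1.C_mul (b i)).add (h1.sing_mul hinj (ha i (by simp))) using 1 <;> ring

end SetFun

/-- Almost all tuples have distinct entries, if some real function has null level sets. -/
theorem ae_injective {α : Type*} [MeasureSpace α] [SigmaFinite (volume : Measure α)]
    {h : α → ℝ} (hm : Measurable h) (h0 : ∀ c, volume (h ⁻¹' {c}) = 0) (n : ℕ) :
    ∀ᵐ X : Fin n → α, Function.Injective X := by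
  have key : ∀ i j : Fin n, i ≠ j → ∀ᵐ X : Fin n → α, h (X i) ≠ h (X j) := by
    rcases n with _ | n
    · exact fun i => i.elim0
    intro i j hij
    obtain ⟨l, rfl⟩ := Fin.exists_succAbove_eq hij.symm
    have hms : MeasurableSet {p : α × (Fin n → α) | h p.1 = h (p.2 l)} :=
      measurableSet_eq_fun (by fun_prop) (by fun_prop)
    have hnull : (volume : Measure (α × (Fin n → α))) {p | h p.1 = h (p.2 l)} = 0 := by
      rw [Measure.volume_eq_prod, Measure.prod_apply_symm hms]
      exact lintegral_eq_zero_of_ae_eq_zero (.of_forall fun Y => h0 (h (Y l)))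
    have := (volume_preserving_piFinSuccAbove (fun _ : Fin (n + 1) => α) i).quasiMeasurePreserving.ae
      (p := fun p => h p.1 ≠ h (p.2 l)) (by rw [ae_iff]; simpa using hnull)
    exact this
  have : ∀ᵐ X : Fin n → α, ∀ i j : Fin n, i ≠ j → h (X i) ≠ h (X j) := by
    simp only [ae_all_iff]
    exact fun i j hij => key i j hij
  filter_upwards [this] with X hX i j hij
  by_contra hne
  exact hX i j hne (by rw [hij])

/-! ### The measure space of trajectories -/

namespace Trajectory

variable {k nx : ℕ}

instance : Finite (TrajIndex k) := by
  refine Set.Finite.subset ((Set.finite_Iic k).prod (Set.finite_Iic (k + 1))) ?_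
  rintro ⟨t, ν⟩ h
  simp only [Set.mem_prod, Set.mem_Iic]
  have h : t ≤ k ∧ 1 ≤ ν ∧ t + ν ≤ k + 1 := h
  omega

theorem measurable_mk (q : TrajIndex k) :
    Measurable fun x : Fin q.1.2 → (Fin nx → ℝ) => (⟨q, x⟩ : Trajectory k nx) :=
  fun _ hs => MeasurableSpace.measurableSet_iInf.1 hs q

theorem measurable_iff {β : Type*} [MeasurableSpace β] {g : Trajectory k nx → β} :
    Measurable g ↔ ∀ q : TrajIndex k, Measurable fun x => g ⟨q, x⟩ := by
  refine ⟨fun h q => h.comp (measurable_mk q), fun h s hs => ?_⟩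
  exact MeasurableSpace.measurableSet_iInf.2 fun q => h q hs

instance : SigmaFinite (volume : Measure (Trajectory k nx)) := by
  have : ∀ q : TrajIndex k, SigmaFinite ((volume : Measure (Fin q.1.2 → (Fin nx → ℝ))).map
      (fun x => (⟨q, x⟩ : Trajectory k nx))) := fun q => by
    refine MeasurableEmbedding.sigmaFinite_map
      ⟨fun _ _ h => sigma_mk_injective h, measurable_mk q, fun {s} hs => ?_⟩
    refine MeasurableSpace.measurableSet_iInf.2 fun q' => ?_
    change MeasurableSet (Sigma.mk q' ⁻¹' ((fun x => (⟨q, x⟩ : Trajectory k nx)) '' s))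
    by_cases h : q = q'
    · subst h
      rwa [Set.preimage_image_eq _ fun _ _ h => sigma_mk_injective h]
    · convert MeasurableSet.empty
      ext x
      simp only [Set.mem_preimage, Set.mem_image, Set.mem_empty_iff_false, iff_false]
      rintro ⟨y, _, hy⟩
      exact h (congrArg Sigma.fst hy)
  exact sum.sigmaFinite _

theorem measurable_last : Measurable (last : Trajectory k nx → Fin nx → ℝ) :=
  measurable_iff.2 fun q => measurable_pi_apply
    (⟨q.1.2 - 1, Nat.sub_lt q.2.2.1 Nat.one_pos⟩ : Fin q.1.2)

/-- Tuples of trajectories with equal entries are null, as one coordinate of the last state has null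
level sets. This needs `0 < nx`. -/
theorem ae_injective (hnx : 0 < nx) (n : ℕ) :
    ∀ᵐ X : Fin n → Trajectory k nx, Function.Injective X := by
  refine TPMB.ae_injective (h := fun X => X.last ⟨0, hnx⟩)
    ((measurable_pi_apply _).comp measurable_last) (fun c => ?_) n
  change (Measure.sum _) _ = 0
  have hm : MeasurableSet ((fun X : Trajectory k nx => X.last ⟨0, hnx⟩) ⁻¹' {c}) :=
    ((measurable_pi_apply _).comp measurable_last) (measurableSet_singleton c)
  rw [Measure.sum_apply _ hm, ENNReal.tsum_eq_zero]
  intro q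
  rw [Measure.map_apply (measurable_mk q) hm]
  set e : Fin q.1.2 := ⟨q.1.2 - 1, Nat.sub_lt q.2.2.1 Nat.one_pos⟩ with he
  change volume {x : Fin q.1.2 → Fin nx → ℝ | x e ⟨0, hnx⟩ = c} = 0
  have h1 : (volume : Measure (Fin nx → ℝ)) {y | y ⟨0, hnx⟩ = c} = 0 :=
    Measure.pi_hyperplane (fun _ : Fin nx => (volume : Measure ℝ)) _ c
  exact (Measure.quasiMeasurePreserving_eval (fun _ => (volume : Measure (Fin nx → ℝ))) e
    ).preimage_null h1

end Trajectory

open SetFun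

variable {k nx nz n m : ℕ}

/-! ### The likelihood as a multiplicative set function -/

namespace MeasurementModel

variable (M : MeasurementModel nx nz)

/-- The density at `y` of detecting a trajectory and measuring `y`. -/
def detect (y : Fin nz → ℝ) (X : Trajectory k nx) : ℝ := M.trajL y X * M.trajPD X

/-- The measurement density of a single trajectory, as a function of the set of the indices of the
measurements that it generates. -/
def factor (z : Fin m → Fin nz → ℝ) (X : Trajectory k nx) : SetFun (Fin m) ℝ :=
  C (1 - M.trajPD X) + ∑ j, C (M.detect (z j) X) * ind ℝ {j}

/-- The density of the clutter, as a function of the set of the indices of the measurements that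
are clutter. -/
def clutterFactor (z : Fin m → Fin nz → ℝ) : SetFun (Fin m) ℝ :=
  C (Real.exp (-∫ y, M.clutter y)) * ∏ j, (1 + C (M.clutter (z j)) * ind ℝ {j})

/-- The likelihood is the value at the full index set of a constant times a multiplicative function of
the set of trajectories. -/
theorem likelihood_eq (z : Fin m → Fin nz → ℝ) (hz : Function.Injective z)
    (S : Finset (Trajectory k nx)) :
    M.likelihood (tupleSet z) S =
      (M.clutterFactor z * ∏ X ∈ S, M.factor z X : SetFun (Fin m) ℝ) Finset.univ := by
  classical
  have h1 : M.likelihood (tupleSet z) S = (∏ o : Option {X // X ∈ S}, Option.elim o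
      (⟨poissonDensity M.clutter⟩ : SetFun (Fin nz → ℝ) ℝ)
      (fun X => ⟨bernoulliDensity (M.trajPD X.1) fun y => M.trajL y X.1⟩)) (tupleSet z) := by
    rw [SetFun.prod_apply, likelihood]
    refine Finset.sum_congr rfl fun P _ => ?_
    rw [Fintype.prod_option]
    rfl
  have h2 : tupleSet z = Finset.univ.map ⟨z, hz⟩ := by
    rw [tupleSet_eq_image, Finset.map_eq_image]
    rfl
  rw [h1, h2, ← comap_apply, map_prod, Fintype.prod_option]
  congr 2
  · simp only [Option.elim, poissonDensity_eq, map_mul, comap_C, comap_power, clutterFactor]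
    rw [power_eq_prod]
    rfl
  · rw [← Finset.prod_coe_sort S]
    refine Finset.prod_congr rfl fun X _ => ?_
    simp only [Option.elim, bernoulliDensity_eq, map_add, comap_C, comap_sing, factor]
    rw [sing_eq_sum]
    simp only [detect, mul_comm (M.trajPD X.1)]
    rfl

end MeasurementModel

theorem PMB.density_eq {α : Type*} [MeasureSpace α] (f : PMB α n) :
    (⟨f.density⟩ : SetFun α ℝ) = C (Real.exp (-∫ x, f.intensity x)) * power f.intensity *
      ∏ i, (C (1 - f.r i) + sing fun x => f.r i * f.p i x) := by
  have h : (⟨f.density⟩ : SetFun α ℝ) = ∏ o : Option (Fin n), Option.elim o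
      (⟨poissonDensity f.intensity⟩ : SetFun α ℝ)
      (fun i => ⟨bernoulliDensity (f.r i) (f.p i)⟩) := by
    ext S
    rw [SetFun.prod_apply]
    refine Finset.sum_congr rfl fun P _ => ?_
    rw [Fintype.prod_option]
    rfl
  rw [h, Fintype.prod_option]
  simp only [Option.elim, poissonDensity_eq, bernoulliDensity_eq]

/-! ### The unnormalised local hypotheses -/

section Update

variable (M : MeasurementModel nx nz) (f : PMB (Trajectory k nx) n) (z : Fin m → Fin nz → ℝ)

/-- The value at `∅` of the Bernoulli density of a local hypothesis, multiplied by its weight. -/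
def absent : ∀ i, LocalHyp n m i → ℝ
  | .inl i, none => 1 - f.r i
  | .inl _, some _ => 0
  | .inr _, false => 1
  | .inr j, true => M.clutter (z j)

/-- The values at singletons of the Bernoulli density of a local hypothesis, multiplied by its
weight. -/
def present : ∀ i, LocalHyp n m i → Trajectory k nx → ℝ
  | .inl i, none => fun X => f.r i * ((1 - M.trajPD X) * f.p i X)
  | .inl i, some j => fun X => f.r i * (f.p i X * M.detect (z j) X)
  | .inr _, false => fun _ => 0
  | .inr j, true => fun X => f.intensity X * M.detect (z j) X

/-- The Bernoulli density of a local hypothesis, multiplied by its weight. No quotients are needed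
to define it. -/
def weighted (i : Fin n ⊕ Fin m) (a : LocalHyp n m i) : SetFun (Trajectory k nx) ℝ :=
  C (absent M f z i a) + sing (present M f z i a)

theorem sum_localHyp_inl {β : Type*} [AddCommMonoid β] (i : Fin n)
    (F : LocalHyp n m (.inl i) → β) :
    ∑ a, F a = F (none : Option (Fin m)) + ∑ j : Fin m, F (some j : Option (Fin m)) :=
  Fintype.sum_option (α := Fin m) F

theorem sum_localHyp_inr {β : Type*} [AddCommMonoid β] (j : Fin m)
    (F : LocalHyp n m (.inr j) → β) :
    ∑ a, F a = F true + F false :=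
  Fintype.sum_bool F

/-- The global hypotheses are the choices whose index sets partition the set of measurements. -/
theorem measIndices_mem_splits (a : ∀ i, LocalHyp n m i) :
    (fun i => measIndices i (a i)) ∈ splits (Fin n ⊕ Fin m) (Finset.univ : Finset (Fin m)) ↔
      a ∈ globalHyps n m := by
  simp only [mem_splits, globalHyps, Finset.mem_filter, Finset.mem_univ, true_and, true_iff,
    Finset.eq_univ_iff_forall, Finset.mem_biUnion]
  exact and_comm

/-- An old Bernoulli component, multiplied pointwise by the measurement densities of its
trajectories, is the sum of its weighted local hypotheses. -/
theorem twist_bernoulli (i : Fin n) :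
    twist (M.factor z) (map C (C (1 - f.r i) + sing fun X => f.r i * f.p i X)) =
      ∑ a, C (ind ℝ (measIndices (.inl i) a)) * map C (weighted M f z (.inl i) a) := by
  rw [sum_localHyp_inl]
  simp only [measIndices, weighted, absent, present, ind_empty, map_add, map_C, map_sing, twist_C,
    twist_sing, map_one, one_mul, map_zero, zero_add, ← sing_const_mul]
  rw [← sing_sum, add_assoc, ← sing_add]
  congr 2
  funext X
  simp only [MeasurementModel.factor, Pi.add_apply, Finset.sum_apply, add_mul, Finset.sum_mul]
  congr 1
  · simp only [map_mul]
    ring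
  · refine Finset.sum_congr rfl fun j _ => ?_
    simp only [map_mul]
    ring

/-- The Poisson component, multiplied pointwise by the measurement densities of its trajectories
and by that of the clutter: the undetected trajectories form a Poisson component, and every
measurement is used by the clutter or by one newly detected trajectory. -/
theorem twist_poisson :
    C (∏ j, (1 + C (M.clutter (z j)) * ind ℝ {j})) *
        twist (M.factor z) (map C (power f.intensity)) =
      map C (power fun X => (1 - M.trajPD X) * f.intensity X) *
        ∏ j, ∑ a, C (ind ℝ (measIndices (.inr j) a)) * map C (weighted M f z (.inr j) a) := by
  have hsplit : (fun X => M.factor z X * C (f.intensity X)) =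
      (fun X => C ((1 - M.trajPD X) * f.intensity X)) +
        ∑ j, fun X => ind ℝ {j} * C (f.intensity X * M.detect (z j) X) := by
    funext X
    simp only [MeasurementModel.factor, Pi.add_apply, Finset.sum_apply, add_mul, Finset.sum_mul,
      map_mul]
    congr 1
    refine Finset.sum_congr rfl fun j _ => ?_
    ring
  rw [map_power, twist_power, hsplit, power_add, power_sum, map_prod, map_power, mul_left_comm,
    ← Finset.prod_mul_distrib]
  congr 1
  refine Finset.prod_congr rfl fun j _ => ?_
  have hsq : (C (ind ℝ {j}) * C (ind ℝ {j}) : SetFun (Trajectory k nx) (SetFun (Fin m) ℝ)) = 0 := by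
    rw [← map_mul, ind_singleton_mul_self, map_zero]
  rw [power_eq_one_add_sing, sing_const_mul, sum_localHyp_inr]
  · simp only [measIndices, weighted, absent, present, ind_empty, map_add, map_C, map_sing,
      map_one, map_mul, one_mul]
    have h0 : (sing fun X : Trajectory k nx => C ((fun _ => (0 : ℝ)) X) :
        SetFun (Trajectory k nx) (SetFun (Fin m) ℝ)) = 0 := by
      simp only [map_zero]; exact sing_zero
    simp only [map_zero] at h0 ⊢
    rw [h0]
    have e : ∀ t c s : SetFun (Trajectory k nx) (SetFun (Fin m) ℝ), t * t = 0 →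
        (1 + c * t) * (1 + t * s) = t * (c + s) + 1 := fun t c s h => by
      calc _ = t * (c + s) + 1 + c * s * (t * t) := by ring
        _ = _ := by rw [h, mul_zero, add_zero]
    rw [e _ _ _ hsq, add_zero]
  · intro X Y _
    have := ind_singleton_mul_self (R := ℝ) j
    calc _ = (ind ℝ {j} * ind ℝ {j}) * (C (f.intensity X * M.detect (z j) X) *
          C (f.intensity Y * M.detect (z j) Y)) := by ring
      _ = 0 := by rw [this, zero_mul]

/-- Bayes' numerator is an unnormalised Poisson multi-Bernoulli mixture, at every finite set. -/
theorem likelihood_mul_density (hz : Function.Injective z) :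
    (⟨fun S => M.likelihood (tupleSet z) S * f.density S⟩ : SetFun (Trajectory k nx) ℝ) =
      C (Real.exp (-∫ y, M.clutter y) * Real.exp (-∫ X, f.intensity X)) *
        ∑ a ∈ globalHyps n m, (power (fun X => (1 - M.trajPD X) * f.intensity X) *
          ∏ i, weighted M f z i (a i)) := by
  classical
  have hF : C (M.clutterFactor z) * twist (M.factor z) (map C ⟨f.density⟩) =
      ∑ a : ∀ i, LocalHyp n m i, C (∏ i, ind ℝ (measIndices i (a i))) *
        map C (C (Real.exp (-∫ y, M.clutter y) * Real.exp (-∫ X, f.intensity X)) *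
          (power (fun X => (1 - M.trajPD X) * f.intensity X) *
            ∏ i, weighted M f z i (a i))) := by
    calc C (M.clutterFactor z) * twist (M.factor z) (map C ⟨f.density⟩)
        = C (C (Real.exp (-∫ y, M.clutter y) * Real.exp (-∫ X, f.intensity X))) *
          (C (∏ j, (1 + C (M.clutter (z j)) * ind ℝ {j})) *
            twist (M.factor z) (map C (power f.intensity))) *
          ∏ i, twist (M.factor z) (map C (C (1 - f.r i) + sing fun X => f.r i * f.p i X)) := by
          rw [PMB.density_eq, MeasurementModel.clutterFactor]
          simp only [map_mul, map_prod, map_C, twist_C]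
          ring
      _ = C (C (Real.exp (-∫ y, M.clutter y) * Real.exp (-∫ X, f.intensity X))) *
          map C (power fun X => (1 - M.trajPD X) * f.intensity X) *
          ∏ i, ∑ a, C (ind ℝ (measIndices i a)) * map C (weighted M f z i a) := by
          rw [twist_poisson, Fintype.prod_sum_type]
          simp only [twist_bernoulli M f z]
          ring
      _ = _ := by
          rw [Finset.prod_univ_sum, Finset.mul_sum]
          refine Finset.sum_congr rfl fun a _ => ?_
          rw [Finset.prod_mul_distrib]
          simp only [map_mul, map_prod, map_C]
          ring
  -- evaluate at `S`, and take the coefficient at the full set of measurement indices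
  ext S
  have hS := congrArg (fun F : SetFun (Trajectory k nx) (SetFun (Fin m) ℝ) => F S Finset.univ) hF
  simp only [C_mul_apply, twist_apply, SetFun.sum_apply, map_apply] at hS ⊢
  rw [M.likelihood_eq z hz, mul_comm]
  rw [← mul_assoc, mul_comm, C_mul_apply] at hS
  rw [hS, Finset.mul_sum]
  have : ∀ a : ∀ i, LocalHyp n m i, ∀ r : ℝ,
      ((∏ i, ind ℝ (measIndices i (a i))) * C r : SetFun (Fin m) ℝ) Finset.univ =
        if a ∈ globalHyps n m then r else 0 := by
    intro a r
    rw [mul_comm, C_mul_apply, prod_ind_apply]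
    simp [measIndices_mem_splits]
  simp only [this]
  rw [← Finset.sum_filter, Finset.filter_mem_eq_inter, Finset.univ_inter]

end Update

/-! ### Integrals of the local hypotheses -/

/-- A density is integrable, since the integral of a function that is not is zero. -/
theorem IsDensity.integrable {α : Type*} [MeasureSpace α] {p : α → ℝ} (h : IsDensity p) :
    Integrable p := by
  by_contra hp
  have := h.2.2
  rw [integral_undef hp] at this
  exact zero_ne_one this

namespace MeasurementModel

variable (M : MeasurementModel nx nz)

theorem trajPD_nonneg (X : Trajectory k nx) : 0 ≤ M.trajPD X := by
  unfold trajPD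
  split_ifs
  exacts [M.pD_nonneg _, le_rfl]

theorem trajPD_le_one (X : Trajectory k nx) : M.trajPD X ≤ 1 := by
  unfold trajPD
  split_ifs
  exacts [M.pD_le_one _, zero_le_one]

theorem measurable_trajPD : Measurable (M.trajPD : Trajectory k nx → ℝ) := by
  refine Trajectory.measurable_iff.2 fun q => ?_
  have hl := M.pD_measurable.comp
    ((Trajectory.measurable_last (k := k) (nx := nx)).comp (Trajectory.measurable_mk q))
  by_cases h : q.1.1 + q.1.2 = k + 1
  · convert hl using 1
    funext x
    exact if_pos h
  · convert measurable_const (a := (0 : ℝ)) using 1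
    funext x
    exact if_neg h

theorem detect_nonneg (y : Fin nz → ℝ) (X : Trajectory k nx) : 0 ≤ M.detect y X :=
  mul_nonneg ((M.l_density _).2.1 y) (M.trajPD_nonneg X)

theorem measurable_detect (y : Fin nz → ℝ) :
    Measurable (M.detect y : Trajectory k nx → ℝ) :=
  (M.l_measurable.comp (measurable_const.prodMk Trajectory.measurable_last)).mul
    M.measurable_trajPD

theorem integrable_mul_trajPD {p : Trajectory k nx → ℝ} (hp : Integrable p) :
    Integrable fun X => p X * M.trajPD X :=
  hp.mul_bdd (c := 1) M.measurable_trajPD.aestronglyMeasurable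
    (.of_forall fun X => by
      rw [Real.norm_of_nonneg (M.trajPD_nonneg X)]
      exact M.trajPD_le_one X)

theorem integrable_one_sub_mul {p : Trajectory k nx → ℝ} (hp : Integrable p) :
    Integrable fun X => (1 - M.trajPD X) * p X := by
  convert hp.sub (M.integrable_mul_trajPD hp) using 1
  funext X
  simp only [Pi.sub_apply]
  ring

theorem inn_one_sub {p : Trajectory k nx → ℝ} (hp : IsDensity p) :
    (inn p fun X => 1 - M.trajPD X) = 1 - inn p M.trajPD := by
  have h1 := hp.2.2
  unfold inn
  conv_rhs => rw [← h1]
  rw [← integral_sub hp.integrable (M.integrable_mul_trajPD hp.integrable)]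
  congr 1
  funext X
  ring

theorem inn_trajPD_nonneg {p : Trajectory k nx → ℝ} (hp : ∀ X, 0 ≤ p X) :
    0 ≤ inn p M.trajPD :=
  integral_nonneg fun X => mul_nonneg (hp X) (M.trajPD_nonneg X)

theorem inn_one_sub_nonneg {p : Trajectory k nx → ℝ} (hp : ∀ X, 0 ≤ p X) :
    0 ≤ inn p fun X => 1 - M.trajPD X :=
  integral_nonneg fun X => mul_nonneg (hp X) (sub_nonneg.2 (M.trajPD_le_one X))

theorem inn_detect_nonneg {p : Trajectory k nx → ℝ} (hp : ∀ X, 0 ≤ p X) (y : Fin nz → ℝ) :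
    0 ≤ inn p (M.detect y) :=
  integral_nonneg fun X => mul_nonneg (hp X) (M.detect_nonneg y X)

end MeasurementModel

/-- Normalising `b * p` by the integral `⟨p, b⟩` gives a density. -/
theorem isDensity_div_inn {α : Type*} [MeasureSpace α] {p b q : α → ℝ} (hp : Measurable p)
    (hb : Measurable b) (hp0 : ∀ x, 0 ≤ p x) (hb0 : ∀ x, 0 ≤ b x) (h : inn p b ≠ 0)
    (hq : ∀ x, q x = b x * p x / inn p b) : IsDensity q := by
  obtain rfl : q = fun x => b x * p x / inn p b := funext hq
  refine ⟨(hb.mul hp).div_const _, fun x => ?_, ?_⟩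
  · exact div_nonneg (mul_nonneg (hb0 x) (hp0 x))
      (integral_nonneg fun y => mul_nonneg (hp0 y) (hb0 y))
  · rw [integral_div]
    simp only [mul_comm (b _)]
    exact div_self h

/-- Almost everywhere, the quotient `b * p / ⟨p, b⟩` is not that of a nonzero number by zero. -/
theorem ae_of_inn_eq_zero {α : Type*} [MeasureSpace α] {p b : α → ℝ}
    (hp0 : ∀ x, 0 ≤ p x) (hb0 : ∀ x, 0 ≤ b x) (hi : Integrable fun x => p x * b x) :
    ∀ᵐ x, inn p b = 0 → b x * p x = 0 := by
  by_cases h : inn p b = 0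
  · have := (integral_eq_zero_iff_of_nonneg (fun y => mul_nonneg (hp0 y) (hb0 y)) hi).1 h
    filter_upwards [this] with x hx _
    rw [mul_comm]
    exact hx
  · exact .of_forall fun x h' => absurd h' h

section Update

variable (M : MeasurementModel nx nz) (f : PMB (Trajectory k nx) n) (z : Fin m → Fin nz → ℝ)

theorem integrable_present
    (hp : ∀ i j, Integrable fun X : Trajectory k nx => f.p i X * M.detect (z j) X)
    (hl : ∀ j, Integrable fun X : Trajectory k nx => f.intensity X * M.detect (z j) X) :
    ∀ i a, Integrable (present M f z i a)
  | .inl i, none => (M.integrable_one_sub_mul (f.p_density i).integrable).const_mul _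
  | .inl i, some j => (hp i j).const_mul _
  | .inr _, false => integrable_zero _ _ _
  | .inr j, true => hl j

/-- The weight of a local hypothesis is the set integral of its weighted Bernoulli density. -/
theorem absent_add_integral_present :
    ∀ i a, absent M f z i a + ∫ X, present M f z i a X = updateW M f z i a
  | .inl i, none => by
      have := M.inn_one_sub (f.p_density i)
      simp only [absent, present, updateW, integral_const_mul]
      simp only [inn, mul_comm (f.p i _) (1 - _)] at this
      rw [this]
      simp only [inn]
      ring
  | .inl i, some j => by
      simp only [absent, present, updateW, integral_const_mul, zero_add]
      rfl
  | .inr _, false => by simp [absent, present, updateW]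
  | .inr j, true => rfl

theorem updateW_nonneg : ∀ i a, 0 ≤ updateW M f z i a
  | .inl i, none => by
      have h1 := M.inn_one_sub (f.p_density i)
      have h2 := M.inn_one_sub_nonneg (f.p_density i).2.1
      have h3 := M.inn_trajPD_nonneg (f.p_density i).2.1
      have := f.r_le_one i
      have := f.r_nonneg i
      simp only [updateW]
      nlinarith
  | .inl i, some j => mul_nonneg (f.r_nonneg i) (M.inn_detect_nonneg (f.p_density i).2.1 _)
  | .inr _, false => zero_le_one
  | .inr j, true => add_nonneg (M.clutter_nonneg _) (M.inn_detect_nonneg f.intensity_nonneg _)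

theorem updateR_nonneg : ∀ i a, 0 ≤ updateR M f z i a
  | .inl i, none => div_nonneg
      (mul_nonneg (f.r_nonneg i) (M.inn_one_sub_nonneg (f.p_density i).2.1))
      (updateW_nonneg M f z (.inl i) none)
  | .inl _, some _ => zero_le_one
  | .inr _, false => le_rfl
  | .inr j, true => div_nonneg (M.inn_detect_nonneg f.intensity_nonneg _)
      (updateW_nonneg M f z (.inr j) true)

theorem updateR_le_one : ∀ i a, updateR M f z i a ≤ 1
  | .inl i, none => by
      refine div_le_one_of_le₀ ?_ (updateW_nonneg M f z (.inl i) none)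
      rw [M.inn_one_sub (f.p_density i)]
      linarith [f.r_le_one i]
  | .inl _, some _ => le_rfl
  | .inr _, false => zero_le_one
  | .inr j, true => by
      refine div_le_one_of_le₀ ?_ (updateW_nonneg M f z (.inr j) true)
      exact le_add_of_nonneg_left (M.clutter_nonneg _)

theorem isDensity_updateP : ∀ i a, updateW M f z i a ≠ 0 → updateR M f z i a ≠ 0 →
    IsDensity (updateP M f z i a)
  | .inl i, none => fun _ hr => isDensity_div_inn (f.p_density i).1
      (measurable_const.sub M.measurable_trajPD) (f.p_density i).2.1
      (fun X => sub_nonneg.2 (M.trajPD_le_one X))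
      (fun h => hr (by
        change f.r i * inn (f.p i) ((fun _ => 1) - M.trajPD) / _ = 0
        rw [h, mul_zero, zero_div])) fun _ => rfl
  | .inl i, some j => fun hw _ => isDensity_div_inn (f.p_density i).1
      (M.measurable_detect (z j)) (f.p_density i).2.1 (M.detect_nonneg (z j))
      (right_ne_zero_of_mul hw) fun _ => rfl
  | .inr _, false => fun _ hr => absurd rfl hr
  | .inr j, true => fun _ hr => isDensity_div_inn f.intensity_measurable
      (M.measurable_detect (z j)) f.intensity_nonneg (M.detect_nonneg (z j))
      (fun h => hr ((congrArg (· / _) h).trans (zero_div _))) fun _ => rfl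

theorem updateW_mul_one_sub_updateR :
    ∀ i a, updateW M f z i a * (1 - updateR M f z i a) = absent M f z i a
  | .inl i, none => by
      have h1 := M.inn_one_sub (f.p_density i)
      have h2 := M.inn_one_sub_nonneg (f.p_density i).2.1
      have h3 := f.r_le_one i
      have h4 := f.r_nonneg i
      have h5 := M.inn_trajPD_nonneg (f.p_density i).2.1
      simp only [updateW, updateR, absent, h1] at *
      by_cases h : 1 - f.r i * inn (f.p i) M.trajPD = 0
      · -- here the component exists and is detected, both with probability one
        rw [h, zero_mul]
        nlinarith
      · field_simp
        ring
  | .inl i, some j => by simp [updateR, absent]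
  | .inr _, false => by simp [updateW, updateR, absent]
  | .inr j, true => by
      have h1 := M.inn_detect_nonneg f.intensity_nonneg (z j)
      have h2 := M.clutter_nonneg (z j)
      change (_ + inn f.intensity (M.detect (z j))) *
        (1 - inn f.intensity (M.detect (z j)) / (_ + inn f.intensity (M.detect (z j)))) = _
      simp only [absent]
      by_cases h : M.clutter (z j) + inn f.intensity (M.detect (z j)) = 0
      · rw [h, zero_mul]
        linarith
      · field_simp
        ring

/-- At a trajectory where the single-trajectory densities are not quotients of a nonzero number by
zero, the normalised parameters give back the unnormalised hypotheses. -/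
theorem updateW_mul_updateR_mul_updateP {X : Trajectory k nx}
    (h1 : ∀ i, (inn (f.p i) fun X => 1 - M.trajPD X) = 0 → (1 - M.trajPD X) * f.p i X = 0)
    (h2 : ∀ i j, inn (f.p i) (M.detect (z j)) = 0 → M.detect (z j) X * f.p i X = 0)
    (h3 : ∀ j, inn f.intensity (M.detect (z j)) = 0 → M.detect (z j) X * f.intensity X = 0) :
    ∀ i a, updateW M f z i a * (updateR M f z i a * updateP M f z i a X) = present M f z i a X
  | .inl i, none => by
      have e1 := M.inn_one_sub (f.p_density i)
      have e2 := M.inn_one_sub_nonneg (f.p_density i).2.1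
      have e3 := f.r_le_one i
      have e4 := f.r_nonneg i
      have e5 := M.inn_trajPD_nonneg (f.p_density i).2.1
      have hX := h1 i
      simp only [updateW, updateR, updateP, present]
      by_cases hD : (inn (f.p i) fun X => 1 - M.trajPD X) = 0
      · simp [hD, hX hD]
      · have hW : 1 - f.r i * inn (f.p i) M.trajPD ≠ 0 := by
          intro h
          have : 0 < inn (f.p i) fun X => 1 - M.trajPD X := lt_of_le_of_ne e2 (Ne.symm hD)
          nlinarith
        field_simp
  | .inl i, some j => by
      have hX := h2 i j
      change f.r i * inn (f.p i) (M.detect (z j)) *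
        (1 * (M.detect (z j) X * f.p i X / inn (f.p i) (M.detect (z j)))) =
        f.r i * (f.p i X * M.detect (z j) X)
      by_cases hD : inn (f.p i) (M.detect (z j)) = 0
      · rw [mul_comm (f.p i X), hX hD, hD]
        simp
      · field_simp
  | .inr _, false => by simp [updateR, present]
  | .inr j, true => by
      have hX := h3 j
      have e1 := M.inn_detect_nonneg f.intensity_nonneg (z j)
      have e2 := M.clutter_nonneg (z j)
      change (M.clutter (z j) + inn f.intensity (M.detect (z j))) *
        (inn f.intensity (M.detect (z j)) /
            (M.clutter (z j) + inn f.intensity (M.detect (z j))) *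
          (M.detect (z j) X * f.intensity X / inn f.intensity (M.detect (z j)))) =
        f.intensity X * M.detect (z j) X
      by_cases hD : inn f.intensity (M.detect (z j)) = 0
      · rw [mul_comm (f.intensity X), hX hD, hD]
        simp
      · have hW : M.clutter (z j) + inn f.intensity (M.detect (z j)) ≠ 0 := by
          have : 0 < inn f.intensity (M.detect (z j)) := lt_of_le_of_ne e1 (Ne.symm hD)
          linarith
        field_simp

/-! ### The density of the updated mixture -/

theorem PMBM.density_eq {α : Type*} [MeasureSpace α] {ι : Type} [Fintype ι] {H : ι → Type}
    (g : PMBM α ι H) :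
    (⟨g.density⟩ : SetFun α ℝ) = C (Real.exp (-∫ x, g.intensity x)) * power g.intensity *
      ∑ a ∈ g.hyps, C (g.globalWeight a) * ∏ i, ⟨bernoulliDensity (g.r i (a i)) (g.p i (a i))⟩ := by
  classical
  rw [← poissonDensity_eq, mul_comm]
  ext S
  rw [mul_apply]
  refine Finset.sum_congr rfl fun W _ => ?_
  rw [SetFun.sum_apply, mul_comm]
  congr 1
  refine Finset.sum_congr rfl fun a _ => ?_
  rw [C_mul_apply, SetFun.prod_apply]

/-- The density of the updated mixture, without its normalisation, at a set of trajectories where the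
normalised local hypotheses give back the unnormalised ones. -/
theorem update_density_mul_total {S : Finset (Trajectory k nx)}
    (hS : ∀ X ∈ S, ∀ i a,
      updateW M f z i a * (updateR M f z i a * updateP M f z i a X) = present M f z i a X)
    (hT : ∑ b ∈ globalHyps n m, ∏ i, updateW M f z i (b i) ≠ 0) :
    (∑ b ∈ globalHyps n m, ∏ i, updateW M f z i (b i)) * (update M f z).density S =
      (C (Real.exp (-∫ X : Trajectory k nx, (1 - M.trajPD X) * f.intensity X)) * ∑ a ∈ globalHyps n m,
        (power (fun X => (1 - M.trajPD X) * f.intensity X) * ∏ i, weighted M f z i (a i)) :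
          SetFun (Trajectory k nx) ℝ) S := by
  classical
  set T := ∑ b ∈ globalHyps n m, ∏ i, updateW M f z i (b i) with hTdef
  -- both sides only involve subsets of `S`, where the hypotheses can be compared
  let e : S ↪ Trajectory k nx := Function.Embedding.subtype (· ∈ S)
  have he : Finset.univ.map e = S := by
    ext X
    simp [e]
  have hloc : ∀ i a, C (updateW M f z i a) *
      comap e ⟨bernoulliDensity (updateR M f z i a) (updateP M f z i a)⟩ =
        comap e (weighted M f z i a) := by
    intro i a
    rw [bernoulliDensity_eq, weighted]
    simp only [map_add, comap_C, comap_sing, mul_add, ← map_mul, ← sing_const_mul]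
    rw [updateW_mul_one_sub_updateR]
    congr 2
    funext X
    exact hS X.1 X.2 i a
  have key : comap e (C T * ⟨(update M f z).density⟩) =
      comap e (C (Real.exp (-∫ X : Trajectory k nx, (1 - M.trajPD X) * f.intensity X)) * ∑ a ∈ globalHyps n m,
        (power (fun X => (1 - M.trajPD X) * f.intensity X) * ∏ i, weighted M f z i (a i))) := by
    rw [PMBM.density_eq]
    simp only [map_mul, map_sum, map_prod, comap_C, ← hloc, Finset.mul_sum,
      Finset.prod_mul_distrib, update]
    refine Finset.sum_congr rfl fun a _ => ?_
    have hg : C T * C ((update M f z).globalWeight a) =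
        ∏ i, (C (updateW M f z i (a i)) : SetFun S ℝ) := by
      rw [← map_mul, ← map_prod]
      congr 1
      exact mul_div_cancel₀ _ hT
    rw [← hg]
    simp only [update]
    ring
  have := congrArg (fun φ : SetFun S ℝ => φ Finset.univ) key
  simpa only [comap_apply, he, C_mul_apply] using this

/-- The evidence: `e^{-∫λC - ∫λ + ∫(1 - pD)λ}` times the total weight of the global hypotheses. -/
theorem hasSetIntegral_likelihood_mul_density (hnx : 0 < nx) (hz : Function.Injective z)
    (hp : ∀ i j, Integrable fun X : Trajectory k nx => f.p i X * M.detect (z j) X)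
    (hl : ∀ j, Integrable fun X : Trajectory k nx => f.intensity X * M.detect (z j) X) :
    HasSetIntegral
      (⟨fun S => M.likelihood (tupleSet z) S * f.density S⟩ : SetFun (Trajectory k nx) ℝ)
      (Real.exp (-∫ y, M.clutter y) * Real.exp (-∫ X, f.intensity X) *
        (Real.exp (∫ X : Trajectory k nx, (1 - M.trajPD X) * f.intensity X) *
          ∑ a ∈ globalHyps n m, ∏ i, updateW M f z i (a i))) := by
  rw [likelihood_mul_density M f z hz,
    Finset.mul_sum (globalHyps n m) fun a => ∏ i, updateW M f z i (a i)]
  refine HasSetIntegral.C_mul _ ?_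
  refine HasSetIntegral.sum _ fun a _ => ?_
  simp only [← absent_add_integral_present]
  exact HasSetIntegral.mul_prod (Trajectory.ae_injective hnx) _
    (fun i _ => integrable_present M f z hp hl i (a i))
    (HasSetIntegral.power (Trajectory.ae_injective hnx)
      (M.integrable_one_sub_mul f.intensity_integrable))

end Update

end

end TPMB

theorem lemma3 {k nx nz n m : ℕ} (hnx : 0 < nx)
    (M : TPMB.MeasurementModel nx nz) (f : TPMB.PMB (TPMB.Trajectory k nx) n)
    (z : Fin m → Fin nz → ℝ) (hz : Function.Injective z)
    (hp : ∀ i j, MeasureTheory.Integrable fun X : TPMB.Trajectory k nx =>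
      f.p i X * (M.trajL (z j) X * M.trajPD X))
    (hl : ∀ j, MeasureTheory.Integrable fun X : TPMB.Trajectory k nx =>
      f.intensity X * (M.trajL (z j) X * M.trajPD X))
    (hev : 0 < M.evidence f.density (TPMB.tupleSet z)) :
    -- the number of Bernoulli components and of their local hypotheses
    Fintype.card (Fin n ⊕ Fin m) = n + m ∧
    (∀ i : Fin n, Fintype.card (TPMB.LocalHyp n m (Sum.inl i)) = m + 1) ∧
    (∀ j : Fin m, Fintype.card (TPMB.LocalHyp n m (Sum.inr j)) = 2) ∧
    -- the set integral in Bayes' rule converges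
    TPMB.SetIntegrable (fun S : Finset (TPMB.Trajectory k nx) =>
      M.likelihood (TPMB.tupleSet z) S * f.density S) ∧
    -- the updated parameters are those of a Poisson multi-Bernoulli mixture
    (TPMB.update M f z).IsValid ∧
    -- the posterior density is the density of this mixture
    TPMB.SetAEEq (M.posterior f.density (TPMB.tupleSet z)) (TPMB.update M f z).density ∧
    (TPMB.NonDegenerate M f z →
      ∀ S, M.posterior f.density (TPMB.tupleSet z) S = (TPMB.update M f z).density S) ∧
    -- if the prior is on sets of alive trajectories, so is the posterior
    ((∀ X, ¬ X.IsAlive → f.intensity X = 0 ∧ ∀ i, f.p i X = 0) →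
      ∀ X, ¬ X.IsAlive → (TPMB.update M f z).intensity X = 0 ∧
        ∀ i a, (TPMB.update M f z).p i a X = 0) := by
  open TPMB TPMB.SetFun MeasureTheory in
  have hint := hasSetIntegral_likelihood_mul_density M f z hnx hz hp hl
  have hE : M.evidence f.density (tupleSet z) = _ := hint.setIntegral_eq
  have hT : 0 < ∑ b ∈ globalHyps n m, ∏ i, updateW M f z i (b i) := by
    rw [hE] at hev
    exact pos_of_mul_pos_right (pos_of_mul_pos_right hev (by positivity)) (by positivity)
  have hpost : ∀ S : Finset (Trajectory k nx), (∀ X ∈ S, ∀ i a,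
      updateW M f z i a * (updateR M f z i a * updateP M f z i a X) = present M f z i a X) →
      M.posterior f.density (tupleSet z) S = (update M f z).density S := by
    intro S hS
    have h1 := update_density_mul_total M f z hS hT.ne'
    have h2 := congrArg (fun φ : SetFun (Trajectory k nx) ℝ => φ S)
      (likelihood_mul_density M f z hz)
    simp only [C_mul_apply] at h1 h2
    rw [Real.exp_neg, eq_inv_mul_iff_mul_eq₀ (Real.exp_pos _).ne'] at h1
    rw [MeasurementModel.posterior, hE, h2, ← h1]
    field_simp
  refine ⟨by simp, fun i => ?_, fun j => ?_, hint.1, ?_, fun q => ?_, fun hN S => ?_,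
    fun hA X hX => ⟨?_, ?_⟩⟩
  · exact (Fintype.card_option (α := Fin m)).trans (by simp)
  · exact Fintype.card_bool
  · exact
      { intensity_measurable :=
          (measurable_const.sub M.measurable_trajPD).mul f.intensity_measurable
        intensity_nonneg := fun X =>
          mul_nonneg (sub_nonneg.2 (M.trajPD_le_one X)) (f.intensity_nonneg X)
        intensity_integrable := M.integrable_one_sub_mul f.intensity_integrable
        w_nonneg := updateW_nonneg M f z
        r_nonneg := updateR_nonneg M f z
        r_le_one := updateR_le_one M f z
        p_density := isDensity_updateP M f z
        total_pos := hT }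
  · have hae : ∀ᵐ X : Trajectory k nx, ∀ i a,
        updateW M f z i a * (updateR M f z i a * updateP M f z i a X) = present M f z i a X := by
      have h1 : ∀ᵐ X : Trajectory k nx, ∀ i,
          (inn (f.p i) fun X => 1 - M.trajPD X) = 0 → (1 - M.trajPD X) * f.p i X = 0 :=
        ae_all_iff.2 fun i => ae_of_inn_eq_zero (f.p_density i).2.1
          (fun X => sub_nonneg.2 (M.trajPD_le_one X)) (by
            simpa only [mul_comm] using M.integrable_one_sub_mul (f.p_density i).integrable)
      have h2 : ∀ᵐ X : Trajectory k nx, ∀ i j,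
          inn (f.p i) (M.detect (z j)) = 0 → M.detect (z j) X * f.p i X = 0 :=
        ae_all_iff.2 fun i => ae_all_iff.2 fun j =>
          ae_of_inn_eq_zero (f.p_density i).2.1 (M.detect_nonneg _) (hp i j)
      have h3 : ∀ᵐ X : Trajectory k nx, ∀ j,
          inn f.intensity (M.detect (z j)) = 0 → M.detect (z j) X * f.intensity X = 0 :=
        ae_all_iff.2 fun j => ae_of_inn_eq_zero f.intensity_nonneg (M.detect_nonneg _) (hl j)
      filter_upwards [h1, h2, h3] with X g1 g2 g3
      exact updateW_mul_updateR_mul_updateP M f z g1 g2 g3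
    have hall : ∀ᵐ X : Fin q → Trajectory k nx, ∀ l : Fin q, ∀ i a,
        updateW M f z i a * (updateR M f z i a * updateP M f z i a (X l)) =
          present M f z i a (X l) :=
      ae_all_iff.2 fun l => (Measure.quasiMeasurePreserving_eval
        (fun _ : Fin q => (volume : Measure (Trajectory k nx))) l).ae hae
    filter_upwards [hall] with X hX
    refine hpost _ fun Y hY => ?_
    classical
    rw [tupleSet_eq_image] at hY
    obtain ⟨l, -, rfl⟩ := Finset.mem_image.1 hY
    exact hX l
  · exact hpost S fun X _ => updateW_mul_updateR_mul_updateP M f z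
      (fun i h => hN.1 i h X) (fun i j h => hN.2.1 i j h X) fun j h => hN.2.2 j h X
  · simp [update, (hA X hX).1]
  · rintro (i | j) (_ | _)
    all_goals simp [update, updateP, (hA X hX).1, (hA X hX).2]
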